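/- Let $M$ be an integer $d\times d$ matrix all of whose eigenvalues are greater than $1$ in absolute value, with $m:=|\det M|\ge 2$, and let $D=\{s_0=\mathbf 0,s_1,\dots,s_{m-1}\}\subset\mathbb Z^d$ be a set of digits for $M$, i.e. its elements are pairwise incongruent modulo $M\mathbb Z^d$. Let $X^+$ be the set of all $x=\sum_{j\in\mathbb Z}M^{-j}x_j$, $x_j\in D$, where only finitely many $x_j$ with $j<0$ are nonzero, and let $X^0\subset X^+$ be the set of those $x$ that have such a representation with finitely many nonzero $x_j$ (this finite representation is unique). Let $\widetilde U$ be the set of points $u$ that have two expansions $u=\sum_{j\ge1}M^{-j}u_j=\sum_{j\ge1}M^{-j}u_j'$ with $u_j,u'_j\in D$ and $u_1\ne u_1'$, put $\widetilde X=\bigcup_{h\in X^0}\bigcup_{n\in\mathbb Z}M^n(\widetilde U+h)$ (a Lebesgue null set), and let $X=(X^+\setminus\widetilde X)\cup X^0$. Every $x\in X$ has well-defined digits $x_j$: those of its finite representation if $x\in X^0$, and those of its unique representation otherwise. Let $U=\{x\in X: x_j=\mathbf 0 \text{ for all } j\le 0\}$, let $\gamma_{[k]}=\sum_{j\ge0}M^js_{k_j}$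 for $k=\sum_{j\ge 0}k_jm^j\in\mathbb Z_+$, $0\le k_j<m$, and let $U_{n,k}=M^{-n}\gamma_{[k]}+M^{-n}(U)$ for $n\in\mathbb Z$, $k\in\mathbb Z_+$. Let $M^*$ be the transpose of $M$, let $D^*$ be a set of digits for $M^*$ containing $\mathbf 0$, and let $X^*$, $U^*$ be the sets built in the same way from $M^*$, $D^*$. Let $\mu$ be the Lebesgue measure. For $x\in X$, $\omega\in X^*$ set $$\chi(x,\omega)=\exp\Big(2\pi i\sum_{j\in\mathbb Z}\langle M^{-1}x_j,\omega_{1-j}\rangle\Big).$$ For $f\in L^2(X)$, the functions $$J_lf(\omega)=\frac1{\mu(U)}\int_{M^l(U)}f(x)\overline{\chi(x,\omega)}\,d\mu(x),\qquad l\in\mathbb Z_+,$$ belong to $L^2(X^*)$ and converge in $L^2(X^*)$ as $l\to+\infty$; the limit is denoted by $\widehat f$ and called the Fourier transform of $f$. **Theorem.** Let $f\in L^2(X)$ and $n\in\mathbb Z$. The function $f$ belongs to $\mathcal S_n(X)$, i.e. for every $k\in\mathbb Z_+$ it is almost everywhere equal to a constant on the cell $U_{n,k}$, if and only if $\operatorname{supp}\widehat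 f\subset (M^*)^n(U^*)$, i.e. $\widehat f=0$ almost everywhere on $X^*\setminus (M^*)^n(U^*)$. -/

import Mathlib

open MeasureTheory Filter Topology
open scoped Matrix Pointwise ENNReal

noncomputable section

/-- A dilation matrix `M` (an integer `d × d` matrix all of whose complex eigenvalues have absolute
value greater than `1`), with `m = |det M| ≥ 2`, together with an enumerated set of digits
`s_0 = 0, s_1, …, s_{m-1}`, pairwise incongruent modulo `M`. -/
structure DigitSystem (d : ℕ) where
  M : Matrix (Fin d) (Fin d) ℤ
  two_le : 2 ≤ M.det.natAbs
  dilation : ∀ z : ℂ,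
    Module.End.HasEigenvalue (Matrix.toLin' (M.map (Int.cast : ℤ → ℂ))) z → 1 < ‖z‖
  digit : Fin M.det.natAbs → Fin d → ℤ
  digit_zero : digit ⟨0, by omega⟩ = 0
  digit_incongruent : ∀ i j, (∃ t : Fin d → ℤ, digit i - digit j = M *ᵥ t) → i = j

namespace DigitSystem

variable {d : ℕ} (S : DigitSystem d)

/-- `m = |det M|`. -/
abbrev m : ℕ := S.M.det.natAbs

lemma m_pos : 0 < S.m := lt_of_lt_of_le (by norm_num) S.two_le

/-- The index of the zero digit. -/
def zeroIdx : Fin S.m := ⟨0, S.m_pos⟩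

/-- `M` as a real matrix. -/
def MR : Matrix (Fin d) (Fin d) ℝ := S.M.map (Int.cast : ℤ → ℝ)

/-- The digit `s_i` as a real vector. -/
def digitR (i : Fin S.m) : Fin d → ℝ := fun a => (S.digit i a : ℝ)

/-- `a : ℤ → Fin m` encodes the digit sequence `x_j = s_{a j}`; `S.IsRep a x` says that
`x = ∑_{j ∈ ℤ} M^{-j} x_j`, where only finitely many `x_j` with negative `j` are nonzero. -/
def IsRep (a : ℤ → Fin S.m) (x : Fin d → ℝ) : Prop :=
  {j : ℤ | j < 0 ∧ a j ≠ S.zeroIdx}.Finite ∧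
    HasSum (fun j : ℤ => (S.MR ^ (-j)) *ᵥ S.digitR (a j)) x

/-- A representation with finitely many nonzero digits. -/
def IsFiniteRep (a : ℤ → Fin S.m) (x : Fin d → ℝ) : Prop :=
  S.IsRep a x ∧ {j : ℤ | a j ≠ S.zeroIdx}.Finite

/-- The set `X⁺` of all vectors with a representation. -/
def Xplus : Set (Fin d → ℝ) := {x | ∃ a, S.IsRep a x}

/-- The set `X⁰` of all vectors with a finite representation. -/
def Xzero : Set (Fin d → ℝ) := {x | ∃ a, S.IsFiniteRep a x}

/-- The exceptional subset `Ũ` of the self-similar set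
`U⁺ = {∑_{j ≥ 1} M^{-j} u_j : u_j ∈ D}`: the points of `U⁺` with two such expansions that differ
in the first digit, i.e. the points in at least two of the sets `M⁻¹ (U⁺ + s)`, `s ∈ D`. -/
def Utilde : Set (Fin d → ℝ) :=
  {u | ∃ a b : ℤ → Fin S.m, (∀ j ≤ 0, a j = S.zeroIdx) ∧ (∀ j ≤ 0, b j = S.zeroIdx) ∧
    S.IsRep a u ∧ S.IsRep b u ∧ a 1 ≠ b 1}

/-- The exceptional set `X̃ = ⋃_{h ∈ X⁰} ⋃_{n ∈ ℤ} M^n (Ũ + h)`. -/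
def Xtilde : Set (Fin d → ℝ) :=
  ⋃ h ∈ S.Xzero, ⋃ n : ℤ, (fun u => (S.MR ^ n) *ᵥ (u + h)) '' S.Utilde

/-- The space of `M`-positive vectors `X = (X⁺ \ X̃) ∪ X⁰`. -/
def X : Set (Fin d → ℝ) := (S.Xplus \ S.Xtilde) ∪ S.Xzero

open Classical in
/-- The digit sequence of a vector: the finite representation if there is one, otherwise a
representation if there is one (for a vector of `X` it is unique in both cases). -/
def digits (x : Fin d → ℝ) : ℤ → Fin S.m :=
  if h : ∃ a, S.IsFiniteRep a x then h.choose
  else if h : ∃ a, S.IsRep a x then h.choose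
  else fun _ => S.zeroIdx

/-- The digit `x_j` of `x`, as a real vector. -/
def coord (x : Fin d → ℝ) (j : ℤ) : Fin d → ℝ := S.digitR (S.digits x j)

/-- `U = {x ∈ X : x_j = 0 for all j ≤ 0}`. -/
def U : Set (Fin d → ℝ) := {x | x ∈ S.X ∧ ∀ j ≤ 0, S.coord x j = 0}

/-- The image `M^n (U)`, `n ∈ ℤ`. -/
def dilU (n : ℤ) : Set (Fin d → ℝ) := (fun u => (S.MR ^ n) *ᵥ u) '' S.U

/-- `γ_{[k]} = ∑_{j ≥ 0} M^j s_{k_j}` for `k = ∑_{j ≥ 0} k_j m^j`, `0 ≤ k_j < m`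
(`k_j = 0` for `j ≥ k`, as `k < m ^ k`). -/
def gam (k : ℕ) : Fin d → ℝ :=
  ∑ j ∈ Finset.range k, (S.MR ^ j) *ᵥ S.digitR ⟨k / S.m ^ j % S.m, Nat.mod_lt _ S.m_pos⟩

/-- The cell `U_{n,k} = M^{-n} γ_{[k]} + M^{-n} (U)`. -/
def cell (n : ℤ) (k : ℕ) : Set (Fin d → ℝ) :=
  (fun u => (S.MR ^ (-n)) *ᵥ S.gam k + u) '' S.dilU (-n)

/-- Lebesgue measure on the space `X`. -/
def muX : Measure (Fin d → ℝ) := volume.restrict S.X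

/-- The class `𝒮_n(X)` for functions determined up to null sets: `f` is almost everywhere constant
on every cell `U_{n,k}`, `k = 0, 1, 2, …`. -/
def IsStep (n : ℤ) (f : (Fin d → ℝ) → ℂ) : Prop :=
  ∀ k : ℕ, ∃ c : ℂ, ∀ᵐ x ∂S.muX, x ∈ S.cell n k → f x = c

/-- `supp f ⊂ M^n (U)` for functions determined up to null sets: `f` vanishes at almost every
point of `X` outside `M^n (U)`. -/
def SuppSubset (n : ℤ) (f : (Fin d → ℝ) → ℂ) : Prop :=
  ∀ᵐ x ∂S.muX, x ∉ S.dilU n → f x = 0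

/-- `χ(x, ω) = exp (2πi ∑_{j ∈ ℤ} ⟨M⁻¹ x_j, ω_{1-j}⟩)` for `x ∈ X`, `ω ∈ X*`, where `T` is the
digit system of `X*`; the sum has finitely many nonzero terms. -/
def chi (T : DigitSystem d) (x ω : Fin d → ℝ) : ℂ :=
  Complex.exp (2 * Real.pi * Complex.I *
    ((∑ᶠ j : ℤ, (S.MR⁻¹ *ᵥ S.coord x j) ⬝ᵥ T.coord ω (1 - j) : ℝ) : ℂ))

/-- `J_l f (ω) = μ(U)⁻¹ ∫_{M^l (U)} f(x) conj (χ(x, ω)) dμ(x)`. -/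
def truncFourier (T : DigitSystem d) (l : ℕ) (f : (Fin d → ℝ) → ℂ) (ω : Fin d → ℝ) : ℂ :=
  ((volume.real S.U : ℝ) : ℂ)⁻¹ *
    ∫ x in S.dilU (l : ℤ), f x * (starRingEnd ℂ) (S.chi T x ω)

/-- `g` is (a representative of) the Fourier transform of `f ∈ L²(X)`: the limit of `J_l f` in
`L²(X*)` as `l → ∞`. -/
def IsFourierTransform (T : DigitSystem d) (f g : (Fin d → ℝ) → ℂ) : Prop :=
  MemLp g 2 T.muX ∧
    (∀ l : ℕ, MemLp (S.truncFourier T l f) 2 T.muX) ∧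
    Tendsto (fun l : ℕ => eLpNorm (S.truncFourier T l f - g) 2 T.muX) atTop (𝓝 0)

end DigitSystem

end

/-! Up to null sets, the cells `U_{n,k}` are the cylinders of level `n` (all digits up to position
`n` prescribed), and `(M*)^n(U*)` is the dual cylinder of level `-n` with zero digits. Fix `N ≥ n`
and a large `l`. On the dual cylinder of level `-N` with zero digits, `J_l f` depends only on the
digits of `ω` in `(-N, l]`. It is the finite transform of the integrals of `f` over the cylinders of
level `N` inside `M^l(U)`, with matrix the tensor power of the `m × m` character table `pairing`.
The rows of that table are orthogonal (`pairing_orthogonal`), so Parseval gives `∫ |J_l f|² =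
(c'/c²) m^N ∑ |∫_cylinder f|²` there (`lintegral_digitTransform`), where `c`, `c'` are the measures
of the two self-similar sets.

Subtracting the same identity at level `n` gives the mass of `J_l f` on the annulus between the two
dual cylinders. It is a sum of nonnegative defects, one for each cylinder of level `n`
(`lintegral_diff_digitTransform`). By `energy_sub_eq` a defect is a multiple of the squared
deviations of the integrals over subcylinders from their mean. If `f` is constant on the cylinders,
all defects vanish, and so does the limit `f̂` on every annulus. If `f̂` vanishes on the annuli,
letting `l → ∞` kills every defect; then `f` minus its mean has zero integral over every subcylinder
and vanishes a.e. This is `step_iff_support`. The transforms converge because Parseval and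
Cauchy–Schwarz bound `J_l` on `L²` uniformly in `l` (`exists_tendsto_digitTransform`).

The argument runs in an abstract `IsDigitModel`; `isDigitModel` shows that `X` is one. The
self-similar set is compact and its integer translates cover space (`fracSet_add_lattice`), so it
has positive volume. Comparing volumes, its `m` digit translates overlap only in null sets
(`aedisjoint_digit_add`), hence digits are unique a.e. Test functions are limits of functions of
finitely many digits, so cylinder integrals determine `f` (`ae_eq_zero_of_integral_cyl`). -/

noncomputable section

/-! ### Cylinders and finite windows of digits. -/

section Windows

variable {α β Ω : Type*}

/-- The cylinder of all points whose digits up to position `n` agree with `p`. -/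
def cyl (δ : Ω → ℤ → α) (n : ℤ) (p : ℤ → α) : Set Ω := {x | ∀ j ≤ n, δ x j = p j}

/-- The digit sequence `p`, overwritten by `q` on the window `(n, N]`. -/
def overwrite (p : ℤ → α) {n N : ℤ} (q : Finset.Ioc n N → α) : ℤ → α :=
  fun j => if h : j ∈ Finset.Ioc n N then q ⟨j, h⟩ else p j

lemma overwrite_mem (p : ℤ → α) {n N : ℤ} (q : Finset.Ioc n N → α) (j : Finset.Ioc n N) :
    overwrite p q j = q j := by
  simp only [overwrite, j.2, dite_true, Subtype.coe_eta]

lemma overwrite_of_le (p : ℤ → α) {n N : ℤ} (q : Finset.Ioc n N → α) {j : ℤ} (hj : j ≤ n) :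
    overwrite p q j = p j := by
  have : j ∉ Finset.Ioc n N := by simp only [Finset.mem_Ioc]; omega
  simp only [overwrite, this, dite_false]

lemma cyl_congr (δ : Ω → ℤ → α) {n : ℤ} {p p' : ℤ → α} (h : ∀ j ≤ n, p j = p' j) :
    cyl δ n p = cyl δ n p' := by
  ext x
  exact ⟨fun hx j hj => (hx j hj).trans (h j hj), fun hx j hj => (hx j hj).trans (h j hj).symm⟩

lemma cyl_subset_cyl (δ : Ω → ℤ → α) {n N : ℤ} (hN : n ≤ N) (p : ℤ → α) :
    cyl δ N p ⊆ cyl δ n p := fun _ hx j hj => hx j (hj.trans hN)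

lemma cyl_overwrite_subset (δ : Ω → ℤ → α) {n N : ℤ} (hN : n ≤ N) (p : ℤ → α)
    (q : Finset.Ioc n N → α) : cyl δ N (overwrite p q) ⊆ cyl δ n p := fun _ hx j hj =>
  (hx j (hj.trans hN)).trans (overwrite_of_le p q hj)

lemma mem_cyl_overwrite (δ : Ω → ℤ → α) {n N : ℤ} {p : ℤ → α} {x : Ω} (hx : x ∈ cyl δ n p) :
    x ∈ cyl δ N (overwrite p fun j : Finset.Ioc n N => δ x j) := by
  intro j hj
  by_cases h : j ≤ n
  · rw [overwrite_of_le _ _ h, hx j h]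
  · exact (overwrite_mem p (fun j : Finset.Ioc n N => δ x j)
      ⟨j, Finset.mem_Ioc.2 ⟨not_le.1 h, hj⟩⟩).symm

lemma iUnion_cyl_overwrite (δ : Ω → ℤ → α) {n N : ℤ} (hN : n ≤ N) (p : ℤ → α) :
    ⋃ q : Finset.Ioc n N → α, cyl δ N (overwrite p q) = cyl δ n p := by
  ext x
  simp only [Set.mem_iUnion]
  exact ⟨fun ⟨q, hq⟩ => cyl_overwrite_subset δ hN p q hq, fun hx => ⟨_, mem_cyl_overwrite δ hx⟩⟩

lemma eq_of_mem_cyl_overwrite {δ : Ω → ℤ → α} {n N : ℤ} {p : ℤ → α} {x : Ω}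
    {q : Finset.Ioc n N → α} (hx : x ∈ cyl δ N (overwrite p q)) (j : Finset.Ioc n N) :
    δ x j = q j :=
  (hx j (Finset.mem_Ioc.1 j.2).2).trans (overwrite_mem p q j)

lemma pairwise_disjoint_cyl_overwrite (δ : Ω → ℤ → α) (n N : ℤ) (p : ℤ → α) :
    Pairwise (Function.onFun Disjoint fun q : Finset.Ioc n N → α => cyl δ N (overwrite p q)) := by
  intro q q' hq
  refine Set.disjoint_left.2 fun x hx hx' => hq ?_
  ext j
  rw [← eq_of_mem_cyl_overwrite hx j, eq_of_mem_cyl_overwrite hx' j]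

/-- A window `(n, N]` splits at `k` into the windows `(n, k]` and `(k, N]`. -/
def splitWindow {n k N : ℤ} (hk : n ≤ k) (hN : k ≤ N) :
    (Finset.Ioc n N → α) ≃ (Finset.Ioc n k → α) × (Finset.Ioc k N → α) where
  toFun q := (fun j => q ⟨j, by have := Finset.mem_Ioc.1 j.2; simp only [Finset.mem_Ioc]; omega⟩,
    fun j => q ⟨j, by have := Finset.mem_Ioc.1 j.2; simp only [Finset.mem_Ioc]; omega⟩)
  invFun r j := if h : (j : ℤ) ≤ k
    then r.1 ⟨j, by have := Finset.mem_Ioc.1 j.2; simp only [Finset.mem_Ioc]; omega⟩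
    else r.2 ⟨j, by have := Finset.mem_Ioc.1 j.2; simp only [Finset.mem_Ioc]; omega⟩
  left_inv q := by ext j; by_cases h : (j : ℤ) ≤ k <;> simp [h]
  right_inv r := by
    refine Prod.ext (funext fun j => ?_) (funext fun j => ?_)
    · have := Finset.mem_Ioc.1 j.2
      simp [this.2]
    · have := Finset.mem_Ioc.1 j.2
      simp [this.1]

lemma overwrite_splitWindow {n k N : ℤ} (hk : n ≤ k) (hN : k ≤ N) (p : ℤ → α)
    (q : Finset.Ioc n N → α) :
    overwrite (overwrite p (splitWindow hk hN q).1) (splitWindow hk hN q).2 = overwrite p q := by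
  ext j
  by_cases h1 : j ∈ Finset.Ioc k N
  · have h2 : j ∈ Finset.Ioc n N := by simp only [Finset.mem_Ioc] at *; omega
    simp only [overwrite, h1, h2, dite_true, splitWindow, Equiv.coe_fn_mk]
  · by_cases h3 : j ∈ Finset.Ioc n k
    · have h2 : j ∈ Finset.Ioc n N := by simp only [Finset.mem_Ioc] at *; omega
      simp only [overwrite, h1, h2, h3, dite_true, dite_false, splitWindow, Equiv.coe_fn_mk]
    · have h2 : j ∉ Finset.Ioc n N := by simp only [Finset.mem_Ioc] at *; omega
      simp only [overwrite, h1, h2, h3, dite_false]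

/-- The reflection `j ↦ 1 - j` between the windows `(n, N]` and `(-N, -n]`. -/
def reflectWindow {n N n' N' : ℤ} (hn : n' = -N) (hN : N' = -n) :
    Finset.Ioc n N ≃ Finset.Ioc n' N' where
  toFun j := ⟨1 - j, by have := Finset.mem_Ioc.1 j.2; simp only [Finset.mem_Ioc]; omega⟩
  invFun j := ⟨1 - j, by have := Finset.mem_Ioc.1 j.2; simp only [Finset.mem_Ioc]; omega⟩
  left_inv j := by simp
  right_inv j := by simp

end Windows

/-! ### Parseval for tensor powers of a matrix. -/

section Parseval

open ComplexConjugate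

variable {α β ι κ : Type*} [Fintype α] [Fintype β] [Fintype ι] [Fintype κ]
  [DecidableEq α] [DecidableEq ι] [DecidableEq κ]

/-- Parseval's identity for a matrix with orthogonal rows of squared length `m`. -/
lemma sum_normSq_of_orthogonal_rows (A : α → β → ℂ) (m : ℝ)
    (hA : ∀ a a', ∑ b, conj (A a b) * A a' b = if a = a' then (m : ℂ) else 0) (F : α → ℂ) :
    ∑ b, ‖∑ a, F a * conj (A a b)‖ ^ 2 = m * ∑ a, ‖F a‖ ^ 2 := by
  have key : ∀ z : ℂ, ((‖z‖ ^ 2 : ℝ) : ℂ) = z * conj z := fun z => by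
    rw [Complex.mul_conj, Complex.normSq_eq_norm_sq]
  have : ((∑ b, ‖∑ a, F a * conj (A a b)‖ ^ 2 : ℝ) : ℂ) = ((m * ∑ a, ‖F a‖ ^ 2 : ℝ) : ℂ) := by
    rw [Complex.ofReal_sum, Complex.ofReal_mul, Complex.ofReal_sum]
    simp only [key, map_sum, map_mul, Complex.conj_conj, Finset.sum_mul_sum]
    calc ∑ b, ∑ a, ∑ a', F a * conj (A a b) * (conj (F a') * A a' b)
        = ∑ a, ∑ a', F a * conj (F a') * ∑ b, conj (A a b) * A a' b := by
          rw [Finset.sum_comm]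
          refine Finset.sum_congr rfl fun a _ => ?_
          rw [Finset.sum_comm]
          refine Finset.sum_congr rfl fun a' _ => ?_
          rw [Finset.mul_sum]
          exact Finset.sum_congr rfl fun b _ => by ring
      _ = (m : ℂ) * ∑ a, F a * conj (F a) := by
          simp only [hA, mul_ite, mul_zero, Finset.sum_ite_eq, Finset.mem_univ, if_true]
          rw [Finset.mul_sum]
          exact Finset.sum_congr rfl fun a _ => by ring
  exact_mod_cast this

omit [Fintype α] in
-- A sum of products over all functions factors into a product over positions, so orthogonality of
-- rows passes to tensor powers. The equivalence `e` is there because position `j` of `x` is paired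
-- with position `1 - j` of `ω`.
lemma sum_prod_conj_mul (W : α → β → ℂ) (m : ℝ)
    (hW : ∀ a a', ∑ b, conj (W a b) * W a' b = if a = a' then (m : ℂ) else 0) (e : ι ≃ κ)
    (q q' : ι → α) :
    ∑ r : κ → β, conj (∏ j, W (q j) (r (e j))) * ∏ j, W (q' j) (r (e j)) =
      if q = q' then ((m ^ Fintype.card ι : ℝ) : ℂ) else 0 := by
  classical
  rw [Fintype.sum_equiv (e.arrowCongr (Equiv.refl β)).symm _
    (fun r : ι → β => ∏ j, conj (W (q j) (r j)) * W (q' j) (r j))]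
  · have := Finset.prod_univ_sum (fun _ : ι => (Finset.univ : Finset β))
      (fun j b => conj (W (q j) b) * W (q' j) b)
    rw [Fintype.piFinset_univ] at this
    rw [← this]
    simp only [hW]
    split_ifs with h
    · subst h
      simp
    · obtain ⟨j, hj⟩ := Function.ne_iff.1 h
      exact Finset.prod_eq_zero (Finset.mem_univ j) (if_neg hj)
  · intro r
    rw [map_prod, ← Finset.prod_mul_distrib]
    rfl

end Parseval

/-! ### Abstract digit models and the truncated transform. -/

section DigitModel

open ComplexConjugate

variable {α β Ω Ω' : Type*} [Fintype α] [Fintype β] [MeasurableSpace Ω] [MeasurableSpace Ω']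

/-- A measure space whose points are described, up to null sets, by two-sided digit sequences that
vanish near `-∞`, such that all cylinders of a level have the same measure and an integrable
function is determined by its integrals over cylinders. -/
structure IsDigitModel (μ : Measure Ω) (o : α) (δ : Ω → ℤ → α) (c : ℝ) : Prop where
  pos : 0 < c
  ae_eventually : ∀ᵐ x ∂μ, ∃ N : ℤ, ∀ j ≤ N, δ x j = o
  nullMeasurableSet_cyl : ∀ n p, (∃ N : ℤ, ∀ j ≤ N, p j = o) → NullMeasurableSet (cyl δ n p) μ
  measure_cyl : ∀ n p, (∃ N : ℤ, ∀ j ≤ N, p j = o) →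
    μ (cyl δ n p) = ENNReal.ofReal (c * (Fintype.card α : ℝ) ^ (-n))
  ae_eq_zero : ∀ (f : Ω → ℂ) (n : ℤ) (p : ℤ → α), (∃ N : ℤ, ∀ j ≤ N, p j = o) →
    IntegrableOn f (cyl δ n p) μ →
    (∀ N, n ≤ N → ∀ q : Finset.Ioc n N → α, ∫ x in cyl δ N (overwrite p q), f x ∂μ = 0) →
    ∀ᵐ x ∂μ, x ∈ cyl δ n p → f x = 0

omit [Fintype α] in
lemma eventually_overwrite {o : α} {p : ℤ → α} (hp : ∃ N : ℤ, ∀ j ≤ N, p j = o) {n N : ℤ}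
    (q : Finset.Ioc n N → α) : ∃ N : ℤ, ∀ j ≤ N, overwrite p q j = o := by
  obtain ⟨N', h⟩ := hp
  exact ⟨min N' n, fun j hj => by
    rw [overwrite_of_le p q (hj.trans (min_le_right _ _)), h j (hj.trans (min_le_left _ _))]⟩

namespace IsDigitModel

variable {μ : Measure Ω} {o : α} {δ : Ω → ℤ → α} {c : ℝ}

lemma card_pos (_ : IsDigitModel μ o δ c) : 0 < (Fintype.card α : ℝ) := by
  have : 0 < Fintype.card α := Fintype.card_pos_iff.2 ⟨o⟩
  exact_mod_cast this

lemma measure_cyl_ne_top (H : IsDigitModel μ o δ c) (n : ℤ) {p : ℤ → α}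
    (hp : ∃ N : ℤ, ∀ j ≤ N, p j = o) : μ (cyl δ n p) ≠ ∞ := by
  rw [H.measure_cyl n p hp]
  exact ENNReal.ofReal_ne_top

lemma measureReal_cyl (H : IsDigitModel μ o δ c) (n : ℤ) {p : ℤ → α}
    (hp : ∃ N : ℤ, ∀ j ≤ N, p j = o) : μ.real (cyl δ n p) = c * (Fintype.card α : ℝ) ^ (-n) := by
  rw [Measure.real, H.measure_cyl n p hp, ENNReal.toReal_ofReal]
  have := H.card_pos
  have := H.pos
  positivity

lemma integral_cyl (H : IsDigitModel μ o δ c) {n N : ℤ} (hN : n ≤ N) {p : ℤ → α}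
    (hp : ∃ N : ℤ, ∀ j ≤ N, p j = o) {E : Type*} [NormedAddCommGroup E] [NormedSpace ℝ E]
    {f : Ω → E} (hf : IntegrableOn f (cyl δ n p) μ) :
    ∫ x in cyl δ n p, f x ∂μ =
      ∑ q : Finset.Ioc n N → α, ∫ x in cyl δ N (overwrite p q), f x ∂μ := by
  rw [← iUnion_cyl_overwrite δ hN p] at hf ⊢
  rw [integral_iUnion_ae (fun q => H.nullMeasurableSet_cyl _ _ (eventually_overwrite hp q))
    (fun q q' h => (pairwise_disjoint_cyl_overwrite δ n N p h).aedisjoint) hf, tsum_fintype]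

lemma lintegral_cyl (H : IsDigitModel μ o δ c) {n N : ℤ} (hN : n ≤ N) {p : ℤ → α}
    (hp : ∃ N : ℤ, ∀ j ≤ N, p j = o) (f : Ω → ℝ≥0∞) :
    ∫⁻ x in cyl δ n p, f x ∂μ =
      ∑ q : Finset.Ioc n N → α, ∫⁻ x in cyl δ N (overwrite p q), f x ∂μ := by
  rw [← iUnion_cyl_overwrite δ hN p,
    lintegral_iUnion₀ (fun q => H.nullMeasurableSet_cyl _ _ (eventually_overwrite hp q))
    (fun q q' h => (pairwise_disjoint_cyl_overwrite δ n N p h).aedisjoint), tsum_fintype]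

lemma ae_exists_mem_cyl (H : IsDigitModel μ o δ c) :
    ∀ᵐ x ∂μ, ∃ k : ℕ, x ∈ cyl δ (-(k : ℤ)) fun _ => o := by
  filter_upwards [H.ae_eventually] with x ⟨N, hN⟩
  exact ⟨N.natAbs, fun j hj => hN j (by omega)⟩

lemma lintegral_eq_iSup (H : IsDigitModel μ o δ c) (f : Ω → ℝ≥0∞) :
    ∫⁻ x, f x ∂μ = ⨆ k : ℕ, ∫⁻ x in cyl δ (-(k : ℤ)) fun _ => o, f x ∂μ := by
  rw [← setLIntegral_iUnion_of_directed, ← setLIntegral_univ]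
  · refine (setLIntegral_congr ?_).symm
    rw [ae_eq_univ, ← mem_ae_iff]
    filter_upwards [H.ae_exists_mem_cyl] with x hx using Set.mem_iUnion.2 hx
  · refine directed_of_isDirected_le fun a b hab => cyl_subset_cyl δ ?_ _
    simpa using hab

lemma aestronglyMeasurable_of_cyl (H : IsDigitModel μ o δ c) {f : Ω → ℂ}
    (hf : ∀ᶠ k : ℕ in atTop,
      AEStronglyMeasurable f (μ.restrict (cyl δ (-(k : ℤ)) fun _ => o))) :
    AEStronglyMeasurable f μ := by
  obtain ⟨k₀, hk₀⟩ := eventually_atTop.1 hf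
  have h : AEStronglyMeasurable f (μ.restrict (⋃ k : ℕ, cyl δ (-((k + k₀ : ℕ) : ℤ)) fun _ => o)) :=
    aestronglyMeasurable_iUnion_iff.2 fun k => hk₀ _ (by omega)
  rwa [Measure.restrict_eq_self_of_ae_mem] at h
  filter_upwards [H.ae_exists_mem_cyl] with x ⟨k, hk⟩
  exact Set.mem_iUnion.2 ⟨k, cyl_subset_cyl δ (by push_cast; omega) _ hk⟩

end IsDigitModel

/-- The kernel `κ` is the product over all positions of the values of the matrix `W` at the digits
in mirrored positions. -/
def IsDigitKernel (o : α) (o' : β) (δ : Ω → ℤ → α) (δ' : Ω' → ℤ → β) (W : α → β → ℂ)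
    (κ : Ω → Ω' → ℂ) : Prop :=
  ∀ (l N : ℤ) (x : Ω) (ω : Ω'), (∀ j ≤ -l, δ x j = o) → (∀ i ≤ -N, δ' ω i = o') →
    κ x ω = ∏ j : Finset.Ioc (-l) N, W (δ x j) (δ' ω (1 - j))

/-- The truncated Fourier transform on a digit model. -/
def digitTransform (μ : Measure Ω) (o : α) (δ : Ω → ℤ → α) (c : ℝ) (κ : Ω → Ω' → ℂ) (l : ℤ)
    (f : Ω → ℂ) (ω : Ω') : ℂ :=
  (c : ℂ)⁻¹ * ∫ x in cyl δ (-l) fun _ => o, f x * conj (κ x ω) ∂μ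

/-- The sum of the squared absolute values of the integrals of `f` over the cylinders of level `N`
inside a cylinder of level `n`. -/
def cellEnergy (μ : Measure Ω) (δ : Ω → ℤ → α) (f : Ω → ℂ) (n N : ℤ) (p : ℤ → α) : ℝ :=
  ∑ q : Finset.Ioc n N → α, ‖∫ x in cyl δ N (overwrite p q), f x ∂μ‖ ^ 2

section Transform

variable {μ : Measure Ω} {o : α} {δ : Ω → ℤ → α} {c : ℝ}
  {μ' : Measure Ω'} {o' : β} {δ' : Ω' → ℤ → β} {c' : ℝ} {W : α → β → ℂ} {κ : Ω → Ω' → ℂ}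

omit [Fintype α] [Fintype β] [MeasurableSpace Ω] [MeasurableSpace Ω'] in
-- The reflection `j ↦ 1 - j` matches the windows `(-l, N]` and `(-N, l]`; outside them one of the
-- two paired digits is zero. Hence the kernel is constant on products of such cylinders.
lemma kernel_eq_of_mem (hκ : IsDigitKernel o o' δ δ' W κ) {l N : ℤ} (hl : -l ≤ N)
    {q : Finset.Ioc (-l) N → α} {r : Finset.Ioc (-N) l → β} {x : Ω} {ω : Ω'}
    (hx : x ∈ cyl δ N (overwrite (fun _ => o) q))
    (hω : ω ∈ cyl δ' l (overwrite (fun _ => o') r)) :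
    κ x ω = ∏ j, W (q j) (r (reflectWindow rfl (neg_neg l).symm j)) := by
  rw [hκ l N x ω (cyl_overwrite_subset δ hl _ q hx)
    (cyl_overwrite_subset δ' (by omega) _ r hω)]
  refine Finset.prod_congr rfl fun j _ => ?_
  rw [eq_of_mem_cyl_overwrite hx j, ← eq_of_mem_cyl_overwrite hω]
  rfl

variable (H : IsDigitModel μ o δ c) (H' : IsDigitModel μ' o' δ' c')
  (hκ : IsDigitKernel o o' δ δ' W κ)

include H hκ

omit [Fintype β] [MeasurableSpace Ω'] in
-- For fixed `ω` the kernel is constant on each of finitely many cylinders, so no separate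
-- measurability of `κ` is needed.
lemma integrableOn_mul_kernel {l N : ℤ} (hl : -l ≤ N) {f : Ω → ℂ}
    (hf : IntegrableOn f (cyl δ (-l) fun _ => o) μ) {ω : Ω'}
    (hω : ω ∈ cyl δ' (-N) fun _ => o') :
    IntegrableOn (fun x => f x * conj (κ x ω)) (cyl δ (-l) fun _ => o) μ := by
  rw [← iUnion_cyl_overwrite δ hl] at hf ⊢
  refine integrableOn_finite_iUnion.2 fun q => ?_
  have h := (integrableOn_finite_iUnion.1 hf q).mul_const
    (conj (∏ j, W (q j) (δ' ω (reflectWindow rfl (neg_neg l).symm j))))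
  refine h.congr ?_
  filter_upwards [ae_restrict_mem₀ (H.nullMeasurableSet_cyl _ _
    (eventually_overwrite ⟨0, fun _ _ => rfl⟩ q))] with x hx
  rw [kernel_eq_of_mem hκ hl hx (mem_cyl_overwrite δ' hω)]

omit [Fintype β] [MeasurableSpace Ω'] in
lemma digitTransform_eq {l N : ℤ} (hl : -l ≤ N) {f : Ω → ℂ}
    (hf : IntegrableOn f (cyl δ (-l) fun _ => o) μ) {r : Finset.Ioc (-N) l → β} {ω : Ω'}
    (hω : ω ∈ cyl δ' l (overwrite (fun _ => o') r)) :
    digitTransform μ o δ c κ l f ω = (c : ℂ)⁻¹ * ∑ q : Finset.Ioc (-l) N → α,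
      (∫ x in cyl δ N (overwrite (fun _ => o) q), f x ∂μ) *
        conj (∏ j, W (q j) (r (reflectWindow rfl (neg_neg l).symm j))) := by
  have ho : ∃ N : ℤ, ∀ j ≤ N, (fun _ : ℤ => o) j = o := ⟨0, fun _ _ => rfl⟩
  rw [digitTransform, H.integral_cyl hl ho (integrableOn_mul_kernel H hκ hl hf
    (cyl_overwrite_subset δ' (by omega) _ r hω))]
  congr 1
  refine Finset.sum_congr rfl fun q _ => ?_
  rw [← integral_mul_const]
  refine setIntegral_congr_ae₀ (H.nullMeasurableSet_cyl _ _ (eventually_overwrite ho q))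
    (Eventually.of_forall fun x hx => ?_)
  rw [kernel_eq_of_mem hκ hl hx hω]

omit [Fintype β] [MeasurableSpace Ω'] in
lemma digitTransform_sub {l l' : ℤ} (hl : l ≤ l') {f : Ω → ℂ}
    (hf : IntegrableOn f (cyl δ (-l') fun _ => o) μ) {ω : Ω'}
    (hω : ∃ N : ℤ, ∀ j ≤ N, δ' ω j = o') :
    digitTransform μ o δ c κ l' f ω - digitTransform μ o δ c κ l f ω =
      digitTransform μ o δ c κ l' ((cyl δ (-l) fun _ => o)ᶜ.indicator f) ω := by
  have ho : ∃ N : ℤ, ∀ j ≤ N, (fun _ : ℤ => o) j = o := ⟨0, fun _ _ => rfl⟩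
  have hm := H.nullMeasurableSet_cyl (-l) _ ho
  have hs : (cyl δ (-l) fun _ => o) ⊆ cyl δ (-l') fun _ => o := cyl_subset_cyl δ (by omega) _
  obtain ⟨N, hN⟩ := hω
  have hi : IntegrableOn (fun x => f x * conj (κ x ω)) (cyl δ (-l') fun _ => o) μ :=
    integrableOn_mul_kernel (N := max (-N) (-l')) H hκ (by omega) hf
      fun j hj => hN j (by omega)
  have h1 : ∀ x, (cyl δ (-l) fun _ => o)ᶜ.indicator f x * conj (κ x ω) =
      (cyl δ (-l) fun _ => o)ᶜ.indicator (fun x => f x * conj (κ x ω)) x := fun x => by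
    by_cases h : x ∈ (cyl δ (-l) fun _ => o)ᶜ <;> simp [h]
  simp only [digitTransform, h1]
  have hm' := hm.compl.mono_ac
    (Measure.restrict_le_self (μ := μ) (s := cyl δ (-l') fun _ => o)).absolutelyContinuous
  rw [← mul_sub, integral_indicator₀ hm', Measure.restrict_restrict₀ hm', Set.inter_comm,
    ← Set.sdiff_eq, setIntegral_sdiff₀ hm hi hs]

include H'

/-- The transform is constant on dual cylinders of level `l`, each of measure `c' m^(-l)`. Parseval
over the `N + l` positions of the window contributes `m^(N + l)`, so the dependence on `l` cancels
and `m^N` remains. -/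
lemma lintegral_digitTransform {m : ℝ} (hα : (Fintype.card α : ℝ) = m)
    (hβ : (Fintype.card β : ℝ) = m) [DecidableEq α]
    (hW : ∀ a a', ∑ b, conj (W a b) * W a' b = if a = a' then (m : ℂ) else 0)
    {l N : ℤ} (hl : -l ≤ N) {f : Ω → ℂ} (hf : IntegrableOn f (cyl δ (-l) fun _ => o) μ) :
    ∫⁻ ω in cyl δ' (-N) fun _ => o', ‖digitTransform μ o δ c κ l f ω‖ₑ ^ 2 ∂μ' =
      ENNReal.ofReal (c' / c ^ 2 * (m ^ N * cellEnergy μ δ f (-l) N fun _ => o)) := by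
  have ho : ∃ N : ℤ, ∀ j ≤ N, (fun _ : ℤ => o') j = o' := ⟨0, fun _ _ => rfl⟩
  have hc := H.pos
  have hc' := H'.pos
  have hm : 0 < m := hα ▸ H.card_pos
  rw [H'.lintegral_cyl (show -N ≤ l by omega) ho]
  have h1 : ∀ r : Finset.Ioc (-N) l → β, ∫⁻ ω in cyl δ' l (overwrite (fun _ => o') r),
      ‖digitTransform μ o δ c κ l f ω‖ₑ ^ 2 ∂μ' = ENNReal.ofReal (c' * m ^ (-l) * (c⁻¹ ^ 2 *
        ‖∑ q : Finset.Ioc (-l) N → α, (∫ x in cyl δ N (overwrite (fun _ => o) q), f x ∂μ) *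
        conj (∏ j, W (q j) (r (reflectWindow rfl (neg_neg l).symm j)))‖ ^ 2)) := fun r => by
    -- The constant is left open; the side goal is proved first, and there `digitTransform_eq`
    -- determines it.
    rw [lintegral_congr_ae (g := fun _ => _)]
    rotate_left
    · filter_upwards [ae_restrict_mem₀ (H'.nullMeasurableSet_cyl _ _
        (eventually_overwrite ho r))] with ω hω
      rw [digitTransform_eq H hκ hl hf hω]
    rw [lintegral_const, Measure.restrict_apply_univ,
      H'.measure_cyl _ _ (eventually_overwrite ho r), hβ, ← ofReal_norm,
      ← ENNReal.ofReal_pow (norm_nonneg _), ← ENNReal.ofReal_mul (by positivity), norm_mul, mul_pow,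
      norm_inv, Complex.norm_real, Real.norm_of_nonneg hc.le, mul_comm]
  simp only [h1]
  rw [← ENNReal.ofReal_sum_of_nonneg fun r _ => by positivity, ← Finset.mul_sum, ← Finset.mul_sum]
  congr 1
  rw [sum_normSq_of_orthogonal_rows _ _ (sum_prod_conj_mul W m hW _)]
  have hcard : m ^ Fintype.card (Finset.Ioc (-l) N) = m ^ N * m ^ l := by
    rw [← zpow_natCast, ← zpow_add₀ hm.ne', Fintype.card_coe, Int.card_Ioc]
    congr 1
    omega
  rw [hcard, zpow_neg, cellEnergy]
  field_simp

end Transform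

end DigitModel

/-! ### Energies of cylinder integrals and their growth with the level. -/

section Energy

variable {α Ω : Type*} [Fintype α] [MeasurableSpace Ω]

lemma eLpNorm_two_sq {E : Type*} [NormedAddCommGroup E] (f : Ω → E) (μ : Measure Ω) :
    eLpNorm f 2 μ ^ 2 = ∫⁻ x, ‖f x‖ₑ ^ 2 ∂μ := by
  rw [eLpNorm_eq_lintegral_rpow_enorm_toReal (by norm_num) (by norm_num), ← ENNReal.rpow_natCast,
    ← ENNReal.rpow_mul]
  norm_num

/-- The sum of squared deviations from the mean. -/
lemma sum_norm_sub_mean_sq {ι : Type*} [Fintype ι] (F : ι → ℂ) {M : ℝ} (hM : M ≠ 0)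
    (hι : (Fintype.card ι : ℝ) = M) :
    ∑ i, ‖F i - (M : ℂ)⁻¹ * ∑ k, F k‖ ^ 2 = ∑ i, ‖F i‖ ^ 2 - M⁻¹ * ‖∑ k, F k‖ ^ 2 := by
  have key : ∀ z : ℂ, ((‖z‖ ^ 2 : ℝ) : ℂ) = z * (starRingEnd ℂ) z := fun z => by
    rw [Complex.mul_conj, Complex.normSq_eq_norm_sq]
  have hM' : (M : ℂ) ≠ 0 := Complex.ofReal_ne_zero.2 hM
  set s := ∑ k, F k with hs
  have h : ((∑ i, ‖F i - (M : ℂ)⁻¹ * s‖ ^ 2 : ℝ) : ℂ) =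
      ((∑ i, ‖F i‖ ^ 2 - M⁻¹ * ‖s‖ ^ 2 : ℝ) : ℂ) := by
    rw [Complex.ofReal_sum, Complex.ofReal_sub, Complex.ofReal_sum, Complex.ofReal_mul]
    simp only [key, map_sub, map_mul, map_inv₀, Complex.conj_ofReal, sub_mul, mul_sub,
      Finset.sum_sub_distrib, Complex.ofReal_inv]
    have h1 : ∑ x, F x * ((M : ℂ)⁻¹ * (starRingEnd ℂ) s) =
        (M : ℂ)⁻¹ * (s * (starRingEnd ℂ) s) := by
      rw [← Finset.sum_mul, ← hs]; ring
    have h2 : ∑ x, (M : ℂ)⁻¹ * s * (starRingEnd ℂ) (F x) =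
        (M : ℂ)⁻¹ * (s * (starRingEnd ℂ) s) := by
      rw [← Finset.mul_sum, ← map_sum, ← hs]; ring
    rw [h1, h2, Finset.sum_const, Finset.card_univ, nsmul_eq_mul,
      show ((Fintype.card ι : ℕ) : ℂ) = (M : ℂ) by rw [← hι]; simp]
    field_simp
    ring
  exact_mod_cast h

lemma cellEnergy_split (μ : Measure Ω) (δ : Ω → ℤ → α) (f : Ω → ℂ) {n k N : ℤ} (hk : n ≤ k)
    (hN : k ≤ N) (p : ℤ → α) :
    cellEnergy μ δ f n N p =
      ∑ q : Finset.Ioc n k → α, cellEnergy μ δ f k N (overwrite p q) := by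
  simp only [cellEnergy]
  rw [← Fintype.sum_prod_type']
  refine Fintype.sum_equiv (splitWindow hk hN) _ _ fun q => ?_
  rw [overwrite_splitWindow]

namespace IsDigitModel

variable {μ : Measure Ω} {o : α} {δ : Ω → ℤ → α} {c : ℝ} (H : IsDigitModel μ o δ c)

include H

lemma integrableOn_cyl {f : Ω → ℂ} (hf : MemLp f 2 μ) (n : ℤ) {p : ℤ → α}
    (hp : ∃ N : ℤ, ∀ j ≤ N, p j = o) : IntegrableOn f (cyl δ n p) μ := by
  have : IsFiniteMeasure (μ.restrict (cyl δ n p)) :=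
    ⟨by rw [Measure.restrict_apply_univ]; exact (H.measure_cyl_ne_top n hp).lt_top⟩
  exact (hf.restrict _).integrable (by norm_num)

omit [MeasurableSpace Ω] H in
lemma card_window {n N : ℤ} (hN : n ≤ N) :
    (Fintype.card (Finset.Ioc n N → α) : ℝ) = (Fintype.card α : ℝ) ^ (N - n) := by
  rw [Fintype.card_fun, Fintype.card_coe, Int.card_Ioc, Nat.cast_pow, ← zpow_natCast,
    Int.toNat_of_nonneg (by omega)]

/-- The growth of the energy in a cylinder is the sum of the squared deviations of the integrals
over its subcylinders from their mean. -/
lemma energy_sub_eq {f : Ω → ℂ} (hf : MemLp f 2 μ) {n N : ℤ} (hN : n ≤ N) {p : ℤ → α}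
    (hp : ∃ N : ℤ, ∀ j ≤ N, p j = o) :
    (Fintype.card α : ℝ) ^ N * cellEnergy μ δ f n N p -
        (Fintype.card α : ℝ) ^ n * ‖∫ x in cyl δ n p, f x ∂μ‖ ^ 2 =
      (Fintype.card α : ℝ) ^ N * ∑ q : Finset.Ioc n N → α,
        ‖∫ x in cyl δ N (overwrite p q), f x ∂μ -
          (((Fintype.card α : ℝ) ^ (N - n) : ℝ) : ℂ)⁻¹ * ∫ x in cyl δ n p, f x ∂μ‖ ^ 2 := by
  have hm := H.card_pos
  rw [H.integral_cyl hN hp (H.integrableOn_cyl hf n hp),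
    sum_norm_sub_mean_sq _ (by positivity) (card_window hN), mul_sub, ← mul_assoc,
    zpow_sub₀ hm.ne', inv_div, mul_div_cancel₀ _ (by positivity), cellEnergy]

lemma energy_sub_nonneg {f : Ω → ℂ} (hf : MemLp f 2 μ) {n N : ℤ} (hN : n ≤ N) {p : ℤ → α}
    (hp : ∃ N : ℤ, ∀ j ≤ N, p j = o) :
    0 ≤ (Fintype.card α : ℝ) ^ N * cellEnergy μ δ f n N p -
        (Fintype.card α : ℝ) ^ n * ‖∫ x in cyl δ n p, f x ∂μ‖ ^ 2 := by
  rw [H.energy_sub_eq hf hN hp]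
  positivity

omit H in
-- Energy is additive over the cylinders of the intermediate level `n`, so its growth is the sum of
-- their individual defects.
lemma energy_sub_eq_sum (f : Ω → ℂ) {k n N : ℤ} (hk : k ≤ n) (hN : n ≤ N) (p : ℤ → α) :
    (Fintype.card α : ℝ) ^ N * cellEnergy μ δ f k N p -
        (Fintype.card α : ℝ) ^ n * cellEnergy μ δ f k n p =
      ∑ q : Finset.Ioc k n → α, ((Fintype.card α : ℝ) ^ N * cellEnergy μ δ f n N (overwrite p q) -
        (Fintype.card α : ℝ) ^ n * ‖∫ x in cyl δ n (overwrite p q), f x ∂μ‖ ^ 2) := by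
  rw [cellEnergy_split μ δ f hk hN p, Finset.sum_sub_distrib, Finset.mul_sum, cellEnergy,
    Finset.mul_sum]

/-- Cauchy–Schwarz on each subcylinder: its measure `c m^(-N)` cancels the weight `m^N`, which makes
the bound uniform in `N`. -/
lemma energy_le {f : Ω → ℂ} (hf : MemLp f 2 μ) {n N : ℤ} (hN : n ≤ N) {p : ℤ → α}
    (hp : ∃ N : ℤ, ∀ j ≤ N, p j = o) :
    ENNReal.ofReal ((Fintype.card α : ℝ) ^ N * cellEnergy μ δ f n N p) ≤
      ENNReal.ofReal c * ∫⁻ x in cyl δ n p, ‖f x‖ₑ ^ 2 ∂μ := by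
  have hm := H.card_pos
  have hc := H.pos
  rw [H.lintegral_cyl hN hp, Finset.mul_sum, cellEnergy, Finset.mul_sum,
    ENNReal.ofReal_sum_of_nonneg fun q _ => by positivity]
  refine Finset.sum_le_sum fun q _ => ?_
  have hq := eventually_overwrite hp q
  set s := cyl δ N (overwrite p q)
  have h1 := eLpNorm_le_eLpNorm_mul_rpow_measure_univ (μ := μ.restrict s) (p := 1) (q := 2)
    (by norm_num) (hf.restrict s).1
  have h2 : ‖∫ x in s, f x ∂μ‖ₑ ^ 2 ≤ (∫⁻ x in s, ‖f x‖ₑ ^ 2 ∂μ) * μ s := by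
    calc ‖∫ x in s, f x ∂μ‖ₑ ^ 2 ≤ (eLpNorm f 1 (μ.restrict s)) ^ 2 := by
          gcongr
          rw [eLpNorm_one_eq_lintegral_enorm]
          exact enorm_integral_le_lintegral_enorm f
      _ ≤ (eLpNorm f 2 (μ.restrict s) *
          (μ.restrict s) Set.univ ^ (1 / (1 : ℝ≥0∞).toReal - 1 / (2 : ℝ≥0∞).toReal)) ^ 2 := by
          gcongr
      _ = _ := by
          rw [mul_pow, eLpNorm_two_sq, Measure.restrict_apply_univ, ← ENNReal.rpow_natCast (_ ^ _),
            ← ENNReal.rpow_mul]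
          norm_num
  calc ENNReal.ofReal ((Fintype.card α : ℝ) ^ N * ‖∫ x in s, f x ∂μ‖ ^ 2)
      = ENNReal.ofReal ((Fintype.card α : ℝ) ^ N) * ‖∫ x in s, f x ∂μ‖ₑ ^ 2 := by
        rw [ENNReal.ofReal_mul (by positivity), ENNReal.ofReal_pow (norm_nonneg _), ofReal_norm]
    _ ≤ ENNReal.ofReal ((Fintype.card α : ℝ) ^ N) * ((∫⁻ x in s, ‖f x‖ₑ ^ 2 ∂μ) *
        ENNReal.ofReal (c * (Fintype.card α : ℝ) ^ (-N))) := by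
        rw [← H.measure_cyl N _ hq]
        gcongr
    _ = ENNReal.ofReal ((Fintype.card α : ℝ) ^ N * (c * (Fintype.card α : ℝ) ^ (-N))) *
        ∫⁻ x in s, ‖f x‖ₑ ^ 2 ∂μ := by
        rw [ENNReal.ofReal_mul (p := (Fintype.card α : ℝ) ^ N) (by positivity)]; ring
    _ = _ := by
        rw [mul_left_comm, ← zpow_add₀ hm.ne', add_neg_cancel, zpow_zero, mul_one]

/-- The tails of a square integrable function tend to zero. -/
lemma tendsto_eLpNorm_indicator {f : Ω → ℂ} (hf : MemLp f 2 μ) :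
    Tendsto (fun l : ℕ => eLpNorm ((cyl δ (-(l : ℤ)) fun _ => o)ᶜ.indicator f) 2 μ)
      atTop (𝓝 0) := by
  have ho : ∃ N : ℤ, ∀ j ≤ N, (fun _ : ℤ => o) j = o := ⟨0, fun _ _ => rfl⟩
  have h : Tendsto (fun l : ℕ => ∫⁻ x, ‖(cyl δ (-(l : ℤ)) fun _ => o)ᶜ.indicator f x‖ₑ ^ 2 ∂μ)
      atTop (𝓝 (∫⁻ _, 0 ∂μ)) := by
    refine tendsto_lintegral_of_dominated_convergence' (fun x => ‖f x‖ₑ ^ 2) (fun l => ?_)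
      (fun l => Eventually.of_forall fun x => ?_) ?_ ?_
    · exact ((hf.1.indicator₀ (H.nullMeasurableSet_cyl _ _ ho).compl).enorm).pow_const 2
    · by_cases hx : x ∈ (cyl δ (-(l : ℤ)) fun _ => o)ᶜ <;> simp [hx]
    · rw [← eLpNorm_two_sq]
      exact ENNReal.pow_ne_top hf.2.ne
    · filter_upwards [H.ae_exists_mem_cyl] with x ⟨k, hk⟩
      refine tendsto_const_nhds.congr' ?_
      filter_upwards [eventually_ge_atTop k] with l hl
      have : x ∈ cyl δ (-(l : ℤ)) fun _ => o := cyl_subset_cyl δ (by omega) _ hk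
      simp [this]
  simp only [← eLpNorm_two_sq, lintegral_zero] at h
  have h' := h.ennrpow_const (1 / 2 : ℝ)
  simpa only [← ENNReal.rpow_natCast, ← ENNReal.rpow_mul, Nat.cast_ofNat, ne_eq,
    OfNat.ofNat_ne_zero, not_false_eq_true, mul_one_div_cancel, ENNReal.rpow_one, one_div,
    inv_pos, Nat.ofNat_pos, ENNReal.zero_rpow_of_pos, mul_inv_cancel₀] using h'

end IsDigitModel

end Energy

/-! ### Convergence of the transforms, and the step–support equivalence. -/

section Plancherel

open ComplexConjugate

variable {α β Ω Ω' : Type*} [Fintype α] [Fintype β] [MeasurableSpace Ω] [MeasurableSpace Ω']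
  [DecidableEq α] {μ : Measure Ω} {o : α} {δ : Ω → ℤ → α} {c : ℝ}
  {μ' : Measure Ω'} {o' : β} {δ' : Ω' → ℤ → β} {c' : ℝ} {W : α → β → ℂ} {κ : Ω → Ω' → ℂ}
  (H : IsDigitModel μ o δ c) (H' : IsDigitModel μ' o' δ' c')
  (hκ : IsDigitKernel o o' δ δ' W κ)
  (hcard : Fintype.card β = Fintype.card α)
  (hW : ∀ a a', ∑ b, conj (W a b) * W a' b = if a = a' then ((Fintype.card α : ℝ) : ℂ) else 0)

include H hκ H'

omit [DecidableEq α] in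
lemma aestronglyMeasurable_digitTransform {l : ℕ} {f : Ω → ℂ}
    (hf : IntegrableOn f (cyl δ (-(l : ℤ)) fun _ => o) μ) :
    AEStronglyMeasurable (digitTransform μ o δ c κ l f) μ' := by
  refine H'.aestronglyMeasurable_of_cyl (Eventually.of_forall fun k => ?_)
  rw [← iUnion_cyl_overwrite δ' (show -(k : ℤ) ≤ l by omega)]
  refine aestronglyMeasurable_iUnion_iff.2 fun r => ?_
  obtain ⟨z, hz⟩ : ∃ z, ∀ ω ∈ cyl δ' l (overwrite (fun _ => o') r),
      digitTransform μ o δ c κ l f ω = z :=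
    ⟨_, fun ω hω => digitTransform_eq H hκ (show -(l : ℤ) ≤ k by omega) hf hω⟩
  refine (aestronglyMeasurable_const (b := z)).congr ?_
  filter_upwards [ae_restrict_mem₀ (H'.nullMeasurableSet_cyl _ _
    (eventually_overwrite ⟨0, fun _ _ => rfl⟩ r))] with ω hω
  exact (hz ω hω).symm

include hcard hW

/-- The dual space is exhausted by zero cylinders of level `-k`; on each, finite Parseval and
`energy_le` give a bound that depends on neither `k` nor `l`. -/
lemma eLpNorm_digitTransform_le {l : ℕ} {f : Ω → ℂ} (hf : MemLp f 2 μ) :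
    eLpNorm (digitTransform μ o δ c κ l f) 2 μ' ^ 2 ≤
      ENNReal.ofReal (c' / c) * eLpNorm f 2 μ ^ 2 := by
  have ho : ∃ N : ℤ, ∀ j ≤ N, (fun _ : ℤ => o) j = o := ⟨0, fun _ _ => rfl⟩
  have hc := H.pos
  have hc' := H'.pos
  rw [eLpNorm_two_sq, eLpNorm_two_sq, H'.lintegral_eq_iSup]
  refine iSup_le fun k => ?_
  have hl : -(l : ℤ) ≤ k := by omega
  rw [lintegral_digitTransform H H' hκ rfl (congrArg _ hcard) hW hl (H.integrableOn_cyl hf _ ho),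
    ENNReal.ofReal_mul (by positivity)]
  calc _ ≤ ENNReal.ofReal (c' / c ^ 2) * (ENNReal.ofReal c *
        ∫⁻ x in cyl δ (-(l : ℤ)) fun _ => o, ‖f x‖ₑ ^ 2 ∂μ) := by
        gcongr
        exact H.energy_le hf hl ho
    _ = ENNReal.ofReal (c' / c) * ∫⁻ x in cyl δ (-(l : ℤ)) fun _ => o, ‖f x‖ₑ ^ 2 ∂μ := by
        rw [← mul_assoc, ← ENNReal.ofReal_mul (by positivity)]
        congr 2
        field_simp
    _ ≤ _ := by
        gcongr
        exact Measure.restrict_le_self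

lemma memLp_digitTransform (l : ℕ) {f : Ω → ℂ} (hf : MemLp f 2 μ) :
    MemLp (digitTransform μ o δ c κ l f) 2 μ' := by
  refine ⟨aestronglyMeasurable_digitTransform H H' hκ
    (H.integrableOn_cyl hf _ ⟨0, fun _ _ => rfl⟩), ?_⟩
  have h := eLpNorm_digitTransform_le H H' hκ hcard hW (l := l) hf
  by_contra hn
  rw [not_lt_top_iff.1 hn] at h
  refine absurd h (not_le.2 ?_)
  rw [ENNReal.top_pow (by norm_num)]
  exact ENNReal.mul_lt_top ENNReal.ofReal_lt_top (ENNReal.pow_lt_top hf.2)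

/-- The difference is the transform of the tail of `f`, so the uniform bound applies and yields the
Cauchy property. -/
lemma eLpNorm_digitTransform_sub_le {l l' : ℕ} (hl : l ≤ l') {f : Ω → ℂ} (hf : MemLp f 2 μ) :
    eLpNorm (digitTransform μ o δ c κ l' f - digitTransform μ o δ c κ l f) 2 μ' ≤
      ENNReal.ofReal (c' / c) ^ (1 / 2 : ℝ) *
        eLpNorm ((cyl δ (-(l : ℤ)) fun _ => o)ᶜ.indicator f) 2 μ := by
  have ho : ∃ N : ℤ, ∀ j ≤ N, (fun _ : ℤ => o) j = o := ⟨0, fun _ _ => rfl⟩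
  have hf' : MemLp ((cyl δ (-(l : ℤ)) fun _ => o)ᶜ.indicator f) 2 μ :=
    ⟨hf.1.indicator₀ (H.nullMeasurableSet_cyl _ _ ho).compl,
      (eLpNorm_indicator_le f).trans_lt hf.2⟩
  have h1 : eLpNorm (digitTransform μ o δ c κ l' f - digitTransform μ o δ c κ l f) 2 μ' =
      eLpNorm (digitTransform μ o δ c κ l' ((cyl δ (-(l : ℤ)) fun _ => o)ᶜ.indicator f)) 2 μ' := by
    refine eLpNorm_congr_ae ?_
    filter_upwards [H'.ae_eventually] with ω hω
    exact digitTransform_sub H hκ (by exact_mod_cast hl) (H.integrableOn_cyl hf _ ho) hω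
  rw [h1, ← ENNReal.pow_le_pow_left_iff two_ne_zero, mul_pow,
    ← ENNReal.rpow_natCast (_ ^ _), ← ENNReal.rpow_mul]
  simpa using eLpNorm_digitTransform_le H H' hκ hcard hW (l := l') hf'

/-- The truncated Fourier transforms of a square integrable function converge. -/
theorem exists_tendsto_digitTransform {f : Ω → ℂ} (hf : MemLp f 2 μ) :
    ∃ g, MemLp g 2 μ' ∧
      Tendsto (fun l : ℕ => eLpNorm (digitTransform μ o δ c κ l f - g) 2 μ') atTop (𝓝 0) := by
  have hm := fun l : ℕ => memLp_digitTransform H H' hκ hcard hW l hf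
  set C := ENNReal.ofReal (c' / c) ^ (1 / 2 : ℝ) with hC
  have hCtop : C ≠ ∞ := ENNReal.rpow_ne_top_of_nonneg (by norm_num) ENNReal.ofReal_ne_top
  set b : ℕ → ℝ≥0∞ := fun l => C * eLpNorm ((cyl δ (-(l : ℤ)) fun _ => o)ᶜ.indicator f) 2 μ
  have hb : Tendsto b atTop (𝓝 0) := by
    have := ENNReal.Tendsto.const_mul (H.tendsto_eLpNorm_indicator hf) (Or.inr hCtop)
    rwa [mul_zero] at this
  have hd : ∀ l l' : ℕ, l ≤ l' → edist ((hm l').toLp _) ((hm l).toLp _) ≤ b l := fun l l' hl => by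
    rw [Lp.edist_toLp_toLp]
    exact eLpNorm_digitTransform_sub_le H H' hκ hcard hW hl hf
  have hcauchy : CauchySeq fun l : ℕ => (hm l).toLp (digitTransform μ o δ c κ l f) := by
    refine EMetric.cauchySeq_iff_le_tendsto_0.2 ⟨fun l => b l + b l, fun n m N hn hm => ?_, ?_⟩
    · refine (edist_triangle_right _ _ _).trans (add_le_add (hd N n hn) (hd N m hm))
    · simpa using hb.add hb
  obtain ⟨g, hg⟩ := cauchySeq_tendsto_of_complete hcauchy
  refine ⟨g, Lp.memLp g, ?_⟩
  rw [Lp.tendsto_Lp_iff_tendsto_eLpNorm'] at hg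
  refine hg.congr fun l => eLpNorm_congr_ae ?_
  filter_upwards [(hm l).coeFn_toLp] with x hx
  simp [hx]

/-- Finite Parseval at levels `N` and `n`, subtracted: off the smaller dual cylinder the transform
measures exactly how far `f` is from constant, as seen at level `N`. -/
lemma lintegral_diff_digitTransform {f : Ω → ℂ} (hf : MemLp f 2 μ) {l : ℕ} {n N : ℤ}
    (hl : -(l : ℤ) ≤ n) (hN : n ≤ N) :
    ∫⁻ ω in (cyl δ' (-N) fun _ => o') \ (cyl δ' (-n) fun _ => o'),
      ‖digitTransform μ o δ c κ l f ω‖ₑ ^ 2 ∂μ' =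
    ENNReal.ofReal (c' / c ^ 2 * ∑ q : Finset.Ioc (-(l : ℤ)) n → α,
      ((Fintype.card α : ℝ) ^ N * cellEnergy μ δ f n N (overwrite (fun _ => o) q) -
        (Fintype.card α : ℝ) ^ n *
          ‖∫ x in cyl δ n (overwrite (fun _ => o) q), f x ∂μ‖ ^ 2)) := by
  have ho : ∃ N : ℤ, ∀ j ≤ N, (fun _ : ℤ => o) j = o := ⟨0, fun _ _ => rfl⟩
  have ho' : ∃ N : ℤ, ∀ j ≤ N, (fun _ : ℤ => o') j = o' := ⟨0, fun _ _ => rfl⟩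
  have hi := H.integrableOn_cyl hf (-(l : ℤ)) ho
  have hm := H.card_pos
  have hc := H.pos
  have hc' := H'.pos
  have hsub : (cyl δ' (-n) fun _ => o') ⊆ cyl δ' (-N) fun _ => o' :=
    cyl_subset_cyl δ' (by omega) _
  have h1 := lintegral_digitTransform H H' hκ rfl (congrArg _ hcard) hW (hl.trans hN) hi
  have h2 := lintegral_digitTransform H H' hκ rfl (congrArg _ hcard) hW hl hi
  have h3 : ∫⁻ ω in (cyl δ' (-N) fun _ => o') \ (cyl δ' (-n) fun _ => o'),
        ‖digitTransform μ o δ c κ l f ω‖ₑ ^ 2 ∂μ' +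
      ∫⁻ ω in cyl δ' (-n) fun _ => o', ‖digitTransform μ o δ c κ l f ω‖ₑ ^ 2 ∂μ' =
      ∫⁻ ω in cyl δ' (-N) fun _ => o', ‖digitTransform μ o δ c κ l f ω‖ₑ ^ 2 ∂μ' := by
    rw [← lintegral_add_measure, ← Measure.restrict_union₀
      (Set.disjoint_sdiff_left).aedisjoint (H'.nullMeasurableSet_cyl _ _ ho'),
      Set.sdiff_union_of_subset hsub]
  rw [h1, h2] at h3
  have hE : 0 ≤ cellEnergy μ δ f (-(l : ℤ)) n fun _ => o :=
    Finset.sum_nonneg fun _ _ => by positivity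
  rw [← IsDigitModel.energy_sub_eq_sum f hl hN, mul_sub, ENNReal.ofReal_sub _ (by positivity)]
  exact ENNReal.eq_sub_of_add_eq ENNReal.ofReal_ne_top h3

/-- A square integrable function is a.e. constant on all cylinders of level `n` if and only if its
Fourier transform vanishes a.e. outside the dual cylinder of level `-n` with zero digits. -/
theorem step_iff_support {f : Ω → ℂ} (hf : MemLp f 2 μ) {g : Ω' → ℂ} (hg : MemLp g 2 μ')
    (hfg : Tendsto (fun l : ℕ => eLpNorm (digitTransform μ o δ c κ l f - g) 2 μ') atTop (𝓝 0))
    (n : ℤ) :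
    (∀ p : ℤ → α, (∃ N : ℤ, ∀ j ≤ N, p j = o) → ∃ z : ℂ, ∀ᵐ x ∂μ, x ∈ cyl δ n p → f x = z) ↔
      ∀ᵐ ω ∂μ', ω ∉ (cyl δ' (-n) fun _ => o') → g ω = 0 := by
  have ho : ∃ N : ℤ, ∀ j ≤ N, (fun _ : ℤ => o) j = o := ⟨0, fun _ _ => rfl⟩
  have ho' : ∃ N : ℤ, ∀ j ≤ N, (fun _ : ℤ => o') j = o' := ⟨0, fun _ _ => rfl⟩
  have hm := H.card_pos
  have hc := H.pos
  have hc' := H'.pos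
  have hnull : ∀ N : ℤ, NullMeasurableSet
      ((cyl δ' (-N) fun _ => o') \ (cyl δ' (-n) fun _ => o')) μ' := fun N =>
    (H'.nullMeasurableSet_cyl _ _ ho').diff (H'.nullMeasurableSet_cyl _ _ ho')
  constructor
  · intro hstep
    -- For constant `f` the integrals over subcylinders of equal level agree, so there is no
    -- deviation from the mean.
    have hdef : ∀ (p : ℤ → α), (∃ N : ℤ, ∀ j ≤ N, p j = o) → ∀ N, n ≤ N →
        (Fintype.card α : ℝ) ^ N * cellEnergy μ δ f n N p -
          (Fintype.card α : ℝ) ^ n * ‖∫ x in cyl δ n p, f x ∂μ‖ ^ 2 = 0 := by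
      intro p hp N hN
      obtain ⟨z, hz⟩ := hstep p hp
      have hint : ∀ k, ∀ q : ℤ → α, (∃ N : ℤ, ∀ j ≤ N, q j = o) → cyl δ k q ⊆ cyl δ n p →
          ∫ x in cyl δ k q, f x ∂μ = ((c * (Fintype.card α : ℝ) ^ (-k) : ℝ) : ℂ) * z := by
        intro k q hq hkq
        rw [setIntegral_congr_ae₀ (g := fun _ => z) (H.nullMeasurableSet_cyl _ _ hq)
          (hz.mono fun x hx hxq => hx (hkq hxq)), setIntegral_const, H.measureReal_cyl k hq,
          Complex.real_smul]
      rw [H.energy_sub_eq hf hN hp, Finset.sum_eq_zero, mul_zero]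
      intro q _
      rw [hint N _ (eventually_overwrite hp q) (cyl_overwrite_subset δ hN p q),
        hint n p hp subset_rfl]
      have : (c * (Fintype.card α : ℝ) ^ (-N) : ℝ) =
          ((Fintype.card α : ℝ) ^ (N - n))⁻¹ * (c * (Fintype.card α : ℝ) ^ (-n)) := by
        rw [← zpow_neg, mul_left_comm, ← zpow_add₀ hm.ne']
        congr 2
        ring
      rw [this]
      push_cast
      rw [mul_assoc, sub_self, norm_zero]
      norm_num
    -- The annuli exhaust the complement of the dual cylinder up to a null set; for `k < n` they are
    -- empty.
    have hzero : ∀ k : ℕ, ∀ᵐ ω ∂μ',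
        ω ∈ (cyl δ' (-(k : ℤ)) fun _ => o') \ (cyl δ' (-n) fun _ => o') → g ω = 0 := by
      intro k
      by_cases hk : n ≤ k
      swap
      · refine Eventually.of_forall fun ω hω => absurd ?_ hω.2
        exact cyl_subset_cyl δ' (by omega) _ hω.1
      set A := (cyl δ' (-(k : ℤ)) fun _ => o') \ (cyl δ' (-n) fun _ => o') with hA
      have hJ : ∀ᶠ l : ℕ in atTop, eLpNorm g 2 (μ'.restrict A) ≤
          eLpNorm (digitTransform μ o δ c κ l f - g) 2 μ' := by
        filter_upwards [eventually_ge_atTop n.natAbs] with l hl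
        have h0 := lintegral_diff_digitTransform H H' hκ hcard hW hf
          (show -(l : ℤ) ≤ n by omega) hk
        rw [Finset.sum_eq_zero fun q _ => hdef _ (eventually_overwrite ho q) _ hk, mul_zero,
          ENNReal.ofReal_zero, ← eLpNorm_two_sq] at h0
        have h0' : eLpNorm (digitTransform μ o δ c κ l f) 2 (μ'.restrict A) = 0 := by
          simpa using h0
        have hJm := (memLp_digitTransform H H' hκ hcard hW l hf).1
        calc eLpNorm g 2 (μ'.restrict A)
            = eLpNorm (digitTransform μ o δ c κ l f - (digitTransform μ o δ c κ l f - g)) 2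
              (μ'.restrict A) := by rw [sub_sub_cancel]
          _ ≤ eLpNorm (digitTransform μ o δ c κ l f) 2 (μ'.restrict A) +
              eLpNorm (digitTransform μ o δ c κ l f - g) 2 (μ'.restrict A) :=
              eLpNorm_sub_le hJm.restrict (hJm.sub hg.1).restrict (by norm_num)
          _ ≤ _ := by
              rw [h0', zero_add]
              exact eLpNorm_mono_measure _ Measure.restrict_le_self
      have hg0 : eLpNorm g 2 (μ'.restrict A) = 0 :=
        le_antisymm (ge_of_tendsto hfg hJ) zero_le
      rw [eLpNorm_eq_zero_iff hg.1.restrict (by norm_num), EventuallyEq,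
        ae_restrict_iff'₀ (hnull k)] at hg0
      exact hg0
    filter_upwards [ae_all_iff.2 hzero, H'.ae_exists_mem_cyl] with ω hω ⟨k, hk⟩ hn
    exact hω k ⟨hk, hn⟩
  · intro hsupp p hp
    have hdef : ∀ N, n ≤ N → (Fintype.card α : ℝ) ^ N * cellEnergy μ δ f n N p -
          (Fintype.card α : ℝ) ^ n * ‖∫ x in cyl δ n p, f x ∂μ‖ ^ 2 = 0 := by
      intro N hN
      set A := (cyl δ' (-N) fun _ => o') \ (cyl δ' (-n) fun _ => o') with hA
      set D := (Fintype.card α : ℝ) ^ N * cellEnergy μ δ f n N p -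
          (Fintype.card α : ℝ) ^ n * ‖∫ x in cyl δ n p, f x ∂μ‖ ^ 2 with hD
      obtain ⟨N₀, hN₀⟩ := hp
      -- Once `l` is so large that `p` vanishes up to `-l`, the defect of `p` is one of the
      -- nonnegative terms in the annulus identity. As `g` vanishes on the annulus, the transform
      -- there equals its difference from `g`.
      have hbd : ∀ᶠ l : ℕ in atTop, ENNReal.ofReal (c' / c ^ 2 * D) ≤
          eLpNorm (digitTransform μ o δ c κ l f - g) 2 μ' ^ 2 := by
        filter_upwards [eventually_ge_atTop (max n.natAbs N₀.natAbs)] with l hl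
        have hl1 : -(l : ℤ) ≤ n := by omega
        calc ENNReal.ofReal (c' / c ^ 2 * D)
            ≤ ∫⁻ ω in A, ‖digitTransform μ o δ c κ l f ω‖ₑ ^ 2 ∂μ' := by
              rw [lintegral_diff_digitTransform H H' hκ hcard hW hf hl1 hN]
              refine ENNReal.ofReal_le_ofReal (mul_le_mul_of_nonneg_left ?_ (by positivity))
              refine le_trans (le_of_eq ?_) (Finset.single_le_sum
                (fun q _ => H.energy_sub_nonneg hf hN (eventually_overwrite ho q))
                (Finset.mem_univ fun j : Finset.Ioc (-(l : ℤ)) n => p j))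
              have hpq : ∀ j ≤ n, overwrite (fun _ => o)
                  (fun j : Finset.Ioc (-(l : ℤ)) n => p j) j = p j := by
                intro j hj
                by_cases h : j ≤ -(l : ℤ)
                · rw [overwrite_of_le _ _ h, hN₀ j (by omega)]
                · exact overwrite_mem (fun _ => o) (fun j : Finset.Ioc (-(l : ℤ)) n => p j)
                    ⟨j, Finset.mem_Ioc.2 ⟨not_le.1 h, hj⟩⟩
              rw [hD, cyl_congr δ hpq, cellEnergy, cellEnergy]
              congr 2
              refine Finset.sum_congr rfl fun q _ => ?_
              rw [cyl_congr δ (p := overwrite p q)]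
              intro j _
              by_cases h : j ≤ n
              · rw [overwrite_of_le _ _ h, overwrite_of_le _ _ h, hpq j h]
              · have hj : j ∈ Finset.Ioc n N := Finset.mem_Ioc.2 ⟨not_le.1 h, by assumption⟩
                rw [overwrite_mem _ q ⟨j, hj⟩, overwrite_mem _ q ⟨j, hj⟩]
          _ = ∫⁻ ω in A, ‖(digitTransform μ o δ c κ l f - g) ω‖ₑ ^ 2 ∂μ' := by
              refine lintegral_congr_ae ?_
              rw [EventuallyEq, ae_restrict_iff'₀ (hnull N)]
              filter_upwards [hsupp] with ω hω hA
              rw [Pi.sub_apply, hω hA.2, sub_zero]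
          _ ≤ ∫⁻ ω, ‖(digitTransform μ o δ c κ l f - g) ω‖ₑ ^ 2 ∂μ' :=
              lintegral_mono' Measure.restrict_le_self le_rfl
          _ = _ := (eLpNorm_two_sq _ _).symm
      have hlim := ge_of_tendsto (ENNReal.Tendsto.pow (n := 2) hfg) hbd
      have hD0 : 0 ≤ D := H.energy_sub_nonneg hf hN ⟨N₀, hN₀⟩
      rw [zero_pow two_ne_zero, nonpos_iff_eq_zero, ENNReal.ofReal_eq_zero] at hlim
      have hpos : 0 < c' / c ^ 2 := by positivity
      nlinarith
    set F := ∫ x in cyl δ n p, f x ∂μ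
    -- The only possible constant: the mean of `f` over the cylinder.
    set z : ℂ := (((c * (Fintype.card α : ℝ) ^ (-n))⁻¹ : ℝ) : ℂ) * F with hz
    refine ⟨z, ?_⟩
    have hfi := H.integrableOn_cyl hf n hp
    have hconst : IntegrableOn (fun _ : Ω => z) (cyl δ n p) μ :=
      integrableOn_const (H.measure_cyl_ne_top n hp)
    have := H.ae_eq_zero (fun x => f x - z) n p hp (hfi.sub hconst) fun N hN q => by
      have hq := eventually_overwrite hp q
      have hsub := cyl_overwrite_subset δ hN p q
      rw [integral_sub (hfi.mono_set hsub) (hconst.mono_set hsub), setIntegral_const,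
        H.measureReal_cyl N hq, Complex.real_smul, hz, ← mul_assoc, ← Complex.ofReal_mul]
      have h0 := hdef N hN
      rw [H.energy_sub_eq hf hN hp, mul_eq_zero_iff_left (by positivity),
        Finset.sum_eq_zero_iff_of_nonneg fun _ _ => by positivity] at h0
      have h1 := h0 q (Finset.mem_univ q)
      rw [sq_eq_zero_iff, norm_eq_zero] at h1
      rw [← h1, ← Complex.ofReal_inv]
      congr 4
      rw [mul_inv, zpow_neg, zpow_neg, inv_inv, zpow_sub₀ hm.ne']
      field_simp
    filter_upwards [this] with x hx hxp
    exact sub_eq_zero.1 (hx hxp)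

end Plancherel

namespace DigitSystem

variable {d : ℕ} (S : DigitSystem d)

/-! ### Geometric decay of the powers of the inverse matrix. -/

section Contraction

attribute [local instance] Matrix.linftyOpNormedRing Matrix.linftyOpNormedAlgebra

/-- The powers of a complex matrix with all eigenvalues in the open unit disc decay
geometrically. -/
lemma exists_norm_pow_le_of_spectrum {n : Type*} [Fintype n] [DecidableEq n]
    (B : Matrix n n ℂ) (hB : ∀ z ∈ spectrum ℂ B, ‖z‖ < 1) :
    ∃ C ρ : ℝ, 0 < ρ ∧ ρ < 1 ∧ ∀ k : ℕ, ‖B ^ k‖ ≤ C * ρ ^ k := by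
  have : CompleteSpace (Matrix n n ℂ) := FiniteDimensional.complete ℂ _
  have hr : spectralRadius ℂ B < 1 := by
    rcases (spectrum ℂ B).eq_empty_or_nonempty with h | h
    · simp [spectralRadius, h]
    · exact_mod_cast spectrum.spectralRadius_lt_of_forall_lt_of_nonempty h (r := 1)
        (fun z hz => by exact_mod_cast hB z hz)
  obtain ⟨ρ, hρ1, hρ2⟩ := ENNReal.lt_iff_exists_nnreal_btwn.1 hr
  have hρ0 : 0 < ρ := by
    by_contra h
    have h' : ρ = 0 := by simpa using h
    simp [h'] at hρ1
  have hρ2' : ρ < 1 := by exact_mod_cast hρ2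
  -- Gelfand's formula: the `k`-th roots of the norms tend to the spectral radius, which lies below
  -- `ρ`.
  have hev :=
    (spectrum.pow_nnnorm_pow_one_div_tendsto_nhds_spectralRadius B).eventually_lt_const hρ1
  have hO : (fun k : ℕ => B ^ k) =O[atTop] fun k : ℕ => (ρ : ℝ) ^ k := by
    refine Asymptotics.IsBigO.of_bound 1 ?_
    filter_upwards [hev, eventually_gt_atTop 0] with k hk hk0
    have h1 : (‖B ^ k‖₊ : ℝ≥0∞) ≤ (ρ : ℝ≥0∞) ^ k := by
      have := ENNReal.rpow_le_rpow hk.le (show (0 : ℝ) ≤ k by positivity)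
      rwa [← ENNReal.rpow_mul, one_div_mul_cancel (by positivity), ENNReal.rpow_one,
        ENNReal.rpow_natCast] at this
    have h2 : ‖B ^ k‖₊ ≤ ρ ^ k := by exact_mod_cast h1
    rw [one_mul, Real.norm_of_nonneg (pow_nonneg ρ.coe_nonneg k)]
    exact_mod_cast h2
  -- Since `ρ ^ k` never vanishes, the eventual bound holds for all `k` after enlarging the
  -- constant.
  obtain ⟨C, hC⟩ := (Asymptotics.isBigO_nat_atTop_iff fun k hk => absurd hk (by positivity)).1 hO
  refine ⟨C, ρ, hρ0, hρ2', fun k => (hC k).trans ?_⟩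
  rw [Real.norm_of_nonneg (pow_nonneg ρ.coe_nonneg k)]

lemma det_ne_zero : S.M.det ≠ 0 := fun h => by
  have := S.two_le
  simp [h] at this

lemma det_MR : S.MR.det = (S.M.det : ℝ) := ((Int.castRingHom ℝ).map_det S.M).symm

lemma isUnit_det_MR : IsUnit S.MR.det := by
  rw [det_MR, isUnit_iff_ne_zero]
  exact_mod_cast S.det_ne_zero

/-- Over `ℂ` the eigenvalues of the inverse are the inverses of those of `M`, hence inside the unit
disc; real vectors embed isometrically in the sup norm. -/
lemma exists_norm_inv_pow_mulVec_le : ∃ C ρ : ℝ, 0 < ρ ∧ ρ < 1 ∧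
    ∀ (k : ℕ) (v : Fin d → ℝ), ‖(S.MR ^ (-(k : ℤ))) *ᵥ v‖ ≤ C * ρ ^ k * ‖v‖ := by
  set B : Matrix (Fin d) (Fin d) ℂ := S.M.map (Int.cast : ℤ → ℂ) with hB
  have hBdet : IsUnit B.det := by
    rw [hB, show (S.M.map (Int.cast : ℤ → ℂ)).det = (S.M.det : ℂ) from
      ((Int.castRingHom ℂ).map_det S.M).symm, isUnit_iff_ne_zero]
    exact_mod_cast S.det_ne_zero
  have hBu : IsUnit B := (Matrix.isUnit_iff_isUnit_det B).2 hBdet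
  obtain ⟨C, ρ, h0, h1, h⟩ := exists_norm_pow_le_of_spectrum B⁻¹ fun z hz => by
    have hz0 : z ≠ 0 := by
      rintro rfl
      rw [spectrum.zero_mem_iff] at hz
      exact hz ((Matrix.isUnit_nonsing_inv_iff).2 hBu)
    have hz' : z⁻¹ ∈ spectrum ℂ B := by
      obtain ⟨u, hu⟩ := hBu
      have h2 : B⁻¹ = ((u⁻¹ : (Matrix (Fin d) (Fin d) ℂ)ˣ) : Matrix (Fin d) (Fin d) ℂ) := by
        rw [← hu, Matrix.coe_units_inv]
      rw [h2] at hz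
      rw [← hu]
      have := spectrum.inv₀_mem_inv_iff (R := ℂ) (r := z⁻¹) (a := u)
      rw [inv_inv] at this
      exact this.1 hz
    have h3 := S.dilation z⁻¹ (by
      rw [Module.End.hasEigenvalue_iff_mem_spectrum, Matrix.spectrum_toLin']
      exact hz')
    rw [norm_inv] at h3
    exact (one_lt_inv₀ (norm_pos_iff.2 hz0)).1 h3
  refine ⟨C, ρ, h0, h1, fun k v => ?_⟩
  have hAB : S.MR.map (algebraMap ℝ ℂ) = B := by
    ext i j
    simp [MR, hB]
  have hinv : (S.MR ^ (-(k : ℤ))).map (algebraMap ℝ ℂ) = B⁻¹ ^ k := by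
    rw [Matrix.zpow_neg_natCast, ← Matrix.inv_pow', Matrix.map_pow, ← hAB]
    congr 1
    refine (Matrix.inv_eq_left_inv ?_).symm
    rw [← Matrix.map_mul, Matrix.nonsing_inv_mul _ S.isUnit_det_MR]
    simp
  have hnorm : ∀ w : Fin d → ℝ, ‖(algebraMap ℝ ℂ) ∘ w‖ = ‖w‖ := fun w => by
    simp [Pi.norm_def, Complex.nnnorm_real]
  have hmul : (algebraMap ℝ ℂ) ∘ ((S.MR ^ (-(k : ℤ))) *ᵥ v) =
      (B⁻¹ ^ k) *ᵥ ((algebraMap ℝ ℂ) ∘ v) := by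
    ext i
    rw [Function.comp_apply, RingHom.map_mulVec, hinv]
  rw [← hnorm, ← hnorm v, hmul]
  exact (Matrix.linfty_opNorm_mulVec _ _).trans (mul_le_mul_of_nonneg_right (h k) (norm_nonneg _))

end Contraction

end DigitSystem

namespace DigitSystem

variable {d : ℕ} (S : DigitSystem d)

/-! ### Digit expansions, the self-similar set and its tiles. -/

section Representations

lemma zpow_mulVec_zpow_mulVec (i j : ℤ) (v : Fin d → ℝ) :
    (S.MR ^ i) *ᵥ ((S.MR ^ j) *ᵥ v) = (S.MR ^ (i + j)) *ᵥ v := by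
  rw [Matrix.mulVec_mulVec, Matrix.zpow_add S.isUnit_det_MR]

lemma zpow_neg_mulVec_zpow_mulVec (i : ℤ) (v : Fin d → ℝ) :
    (S.MR ^ (-i)) *ᵥ ((S.MR ^ i) *ᵥ v) = v := by
  rw [zpow_mulVec_zpow_mulVec, neg_add_cancel, zpow_zero, Matrix.one_mulVec]

lemma digitR_zeroIdx : S.digitR S.zeroIdx = 0 := by
  ext a
  simp [digitR, zeroIdx, S.digit_zero]

lemma digitR_eq_zero_iff (i : Fin S.m) : S.digitR i = 0 ↔ i = S.zeroIdx := by
  refine ⟨fun h => ?_, fun h => h ▸ S.digitR_zeroIdx⟩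
  refine S.digit_incongruent _ _ ⟨0, ?_⟩
  rw [Matrix.mulVec_zero, sub_eq_zero, zeroIdx, S.digit_zero]
  ext a
  have := congrFun h a
  simpa [digitR] using this

lemma finite_iff_eventually {m : ℕ} (o : Fin m) (a : ℤ → Fin m) :
    {j : ℤ | j < 0 ∧ a j ≠ o}.Finite ↔ ∃ N : ℤ, ∀ j ≤ N, a j = o := by
  constructor
  · intro h
    obtain ⟨N, hN⟩ := h.bddBelow
    refine ⟨min (N - 1) (-1), fun j hj => ?_⟩
    by_contra hne
    have := hN ⟨by omega, hne⟩
    omega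
  · rintro ⟨N, hN⟩
    refine (Set.finite_Ioo N 0).subset fun j hj => ⟨?_, hj.1⟩
    by_contra h
    exact hj.2 (hN j (by omega))

lemma IsRep.eventually {S : DigitSystem d} {a : ℤ → Fin S.m} {x : Fin d → ℝ} (h : S.IsRep a x) :
    ∃ N : ℤ, ∀ j ≤ N, a j = S.zeroIdx := (finite_iff_eventually _ _).1 h.1

lemma IsRep.shift {S : DigitSystem d} {a : ℤ → Fin S.m} {x : Fin d → ℝ} (h : S.IsRep a x)
    (n : ℤ) : S.IsRep (fun j => a (j + n)) ((S.MR ^ n) *ᵥ x) := by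
  refine ⟨(finite_iff_eventually _ _).2 ?_, ?_⟩
  · obtain ⟨N, hN⟩ := h.eventually
    exact ⟨N - n, fun j hj => hN _ (by omega)⟩
  · have h1 := h.2.map (Matrix.mulVecLin (S.MR ^ n)) (by fun_prop)
    have h2 := (Equiv.addRight n).hasSum_iff.2 h1
    refine h2.congr_fun ?_
    intro j
    simp only [Function.comp_apply, Matrix.mulVecLin_apply, Equiv.coe_addRight,
      zpow_mulVec_zpow_mulVec]
    congr 2
    ring_nf

/-- Digit sequences with disjoint supports can be merged. -/
lemma IsRep.merge {S : DigitSystem d} {a b e : ℤ → Fin S.m} {x y : Fin d → ℝ} (ha : S.IsRep a x)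
    (hb : S.IsRep b y) (hab : ∀ j, (e j = a j ∧ b j = S.zeroIdx) ∨ (e j = b j ∧ a j = S.zeroIdx)) :
    S.IsRep e (x + y) := by
  refine ⟨(ha.1.union hb.1).subset ?_, (ha.2.add hb.2).congr_fun fun j => ?_⟩
  · rintro j ⟨hj, hne⟩
    rcases hab j with h | h
    · exact Or.inl ⟨hj, h.1 ▸ hne⟩
    · exact Or.inr ⟨hj, h.1 ▸ hne⟩
  · rcases hab j with h | h
    · rw [h.1, h.2, digitR_zeroIdx, Matrix.mulVec_zero, add_zero]
    · rw [h.1, h.2, digitR_zeroIdx, Matrix.mulVec_zero, zero_add]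

lemma exists_norm_digitR_le : ∃ R : ℝ, 0 ≤ R ∧ ∀ i, ‖S.digitR i‖ ≤ R :=
  ⟨∑ i, ‖S.digitR i‖, by positivity, fun i =>
    Finset.single_le_sum (f := fun i => ‖S.digitR i‖) (fun _ _ => norm_nonneg _)
      (Finset.mem_univ i)⟩

lemma exists_summable_bound : ∃ u : ℕ → ℝ, Summable u ∧
    ∀ (k : ℕ) i, ‖(S.MR ^ (-((k : ℤ) + 1))) *ᵥ S.digitR i‖ ≤ u k := by
  obtain ⟨C, ρ, h0, h1, h⟩ := S.exists_norm_inv_pow_mulVec_le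
  obtain ⟨R, hR, hdR⟩ := S.exists_norm_digitR_le
  have hC : ∀ k : ℕ, 0 ≤ max C 0 * ρ ^ k := fun k => by positivity
  refine ⟨fun k => max C 0 * ρ ^ (k + 1) * R, ?_, fun k i => ?_⟩
  · exact (((summable_nat_add_iff 1).2 (summable_geometric_of_lt_one h0.le h1)).mul_left _).mul_right
      _
  · have := h (k + 1) (S.digitR i)
    push_cast at this
    refine this.trans ?_
    calc C * ρ ^ (k + 1) * ‖S.digitR i‖ ≤ max C 0 * ρ ^ (k + 1) * ‖S.digitR i‖ := by
          gcongr; exact le_max_left _ _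
      _ ≤ _ := mul_le_mul_of_nonneg_left (hdR i) (hC _)

/-- The point of the self-similar set with a given sequence of digits. -/
def fracVal (b : ℕ → Fin S.m) : Fin d → ℝ :=
  ∑' k : ℕ, (S.MR ^ (-((k : ℤ) + 1))) *ᵥ S.digitR (b k)

/-- The self-similar set `∑_{j ≥ 1} M^{-j} D`. -/
def fracSet : Set (Fin d → ℝ) := Set.range S.fracVal

/-- The Weierstrass M-test on the compact product of the finite digit sets; compactness of `fracSet`
follows. -/
lemma continuous_fracVal : Continuous S.fracVal := by
  obtain ⟨u, hu, hbd⟩ := S.exists_summable_bound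
  refine continuous_tsum (fun k => ?_) hu fun k b => hbd k (b k)
  have : Continuous fun i : Fin S.m => (S.MR ^ (-((k : ℤ) + 1))) *ᵥ S.digitR i :=
    continuous_of_discreteTopology
  exact this.comp (continuous_apply k)

lemma isCompact_fracSet : IsCompact S.fracSet := isCompact_range S.continuous_fracVal

lemma mem_fracSet_iff {x : Fin d → ℝ} :
    x ∈ S.fracSet ↔ ∃ a, (∀ j ≤ 0, a j = S.zeroIdx) ∧ S.IsRep a x := by
  have hinj : Function.Injective fun k : ℕ => (k : ℤ) + 1 := fun a b h => by
    simpa using h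
  have hsupp : ∀ a : ℤ → Fin S.m, (∀ j ≤ 0, a j = S.zeroIdx) →
      ∀ j ∉ Set.range fun k : ℕ => (k : ℤ) + 1, (S.MR ^ (-j)) *ᵥ S.digitR (a j) = 0 := by
    intro a ha j hj
    rw [ha j, digitR_zeroIdx, Matrix.mulVec_zero]
    by_contra h
    exact hj ⟨(j - 1).toNat, by simp only; omega⟩
  have hsum : ∀ b : ℕ → Fin S.m, HasSum
      (fun k : ℕ => (S.MR ^ (-((k : ℤ) + 1))) *ᵥ S.digitR (b k)) (S.fracVal b) := by
    obtain ⟨u, hu, hbd⟩ := S.exists_summable_bound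
    exact fun b => (Summable.of_norm_bounded hu fun k => hbd k (b k)).hasSum
  constructor
  · rintro ⟨b, rfl⟩
    have ha : ∀ j ≤ 0, (fun j : ℤ => if 0 < j then b (j - 1).toNat else S.zeroIdx) j =
        S.zeroIdx := fun j hj => if_neg (not_lt.2 hj)
    refine ⟨_, ha, (finite_iff_eventually _ _).2 ⟨0, ha⟩, ?_⟩
    rw [← hinj.hasSum_iff (hsupp _ ha)]
    refine (hsum b).congr_fun fun k => ?_
    simp only [Function.comp_apply, add_sub_cancel_right, Int.toNat_natCast]
    rw [if_pos (by omega)]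
  · rintro ⟨a, ha, hrep⟩
    refine ⟨fun k => a (k + 1), ?_⟩
    exact (hsum _).unique ((hinj.hasSum_iff (hsupp a ha)).2 hrep.2)

/-- The part of a digit sequence up to position `n`. -/
def head (n : ℤ) (a : ℤ → Fin S.m) : ℤ → Fin S.m := fun j => if j ≤ n then a j else S.zeroIdx

/-- The part of a digit sequence after position `n`. -/
def tail (n : ℤ) (a : ℤ → Fin S.m) : ℤ → Fin S.m := fun j => if j ≤ n then S.zeroIdx else a j

/-- The vector represented by the digits up to position `n`. -/
def headVal (n : ℤ) (a : ℤ → Fin S.m) : Fin d → ℝ :=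
  ∑ᶠ j : ℤ, (S.MR ^ (-j)) *ᵥ S.digitR (S.head n a j)

lemma finite_head {a : ℤ → Fin S.m} (ha : ∃ N : ℤ, ∀ j ≤ N, a j = S.zeroIdx) (n : ℤ) :
    {j : ℤ | S.head n a j ≠ S.zeroIdx}.Finite := by
  obtain ⟨N, hN⟩ := ha
  refine (Set.finite_Ioc N n).subset fun j hj => ⟨?_, ?_⟩
  · by_contra h
    apply hj
    simp [head, hN j (not_lt.1 h)]
  · by_contra h
    apply hj
    simp [head, h]

lemma isFiniteRep_headVal {a : ℤ → Fin S.m} (ha : ∃ N : ℤ, ∀ j ≤ N, a j = S.zeroIdx) (n : ℤ) :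
    S.IsFiniteRep (S.head n a) (S.headVal n a) := by
  have hf := S.finite_head ha n
  have hs : (Function.support fun j : ℤ => (S.MR ^ (-j)) *ᵥ S.digitR (S.head n a j)).Finite := by
    refine hf.subset fun j hj h => hj ?_
    simp only [h, digitR_zeroIdx, Matrix.mulVec_zero]
  refine ⟨⟨hf.subset fun j hj => hj.2, ?_⟩, hf⟩
  rw [headVal, finsum_eq_sum _ hs]
  exact hasSum_sum_of_ne_finset_zero fun j hj => by
    by_contra h
    exact hj (hs.mem_toFinset.2 h)

lemma head_zero_of_lt {n j : ℤ} (hj : n < j) (a : ℤ → Fin S.m) : S.head n a j = S.zeroIdx :=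
  if_neg (not_le.2 hj)

lemma IsRep.tail {S : DigitSystem d} {a : ℤ → Fin S.m} {x : Fin d → ℝ} (h : S.IsRep a x) (n : ℤ) :
    S.IsRep (S.tail n a) (x - S.headVal n a) := by
  have h1 := S.isFiniteRep_headVal h.eventually n
  refine ⟨h.1.subset ?_, (h.2.sub h1.1.2).congr_fun fun j => ?_⟩
  · rintro j ⟨hj, hne⟩
    refine ⟨hj, fun h0 => hne ?_⟩
    simp [DigitSystem.tail, h0]
  · by_cases hj : j ≤ n <;> simp [DigitSystem.tail, head, hj, digitR_zeroIdx]

/-- The translated and dilated copy of the self-similar set that consists of all vectors with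
prescribed digits up to position `n`. -/
def tile (n : ℤ) (p : ℤ → Fin S.m) : Set (Fin d → ℝ) :=
  (fun x => S.headVal n p + (S.MR ^ (-n)) *ᵥ x) '' S.fracSet

lemma mem_tile_iff {p : ℤ → Fin S.m} (hp : ∃ N : ℤ, ∀ j ≤ N, p j = S.zeroIdx) (n : ℤ)
    {x : Fin d → ℝ} : x ∈ S.tile n p ↔ ∃ a, S.IsRep a x ∧ ∀ j ≤ n, a j = p j := by
  constructor
  · rintro ⟨y, hy, rfl⟩
    obtain ⟨a, ha, hrep⟩ := S.mem_fracSet_iff.1 hy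
    have h1 := hrep.shift (-n)
    refine ⟨fun j => if j ≤ n then p j else a (j + -n),
      (S.isFiniteRep_headVal hp n).1.merge h1 fun j => ?_, fun j hj => if_pos hj⟩
    by_cases hj : j ≤ n
    · exact Or.inl ⟨by simp [head, hj], ha _ (by omega)⟩
    · exact Or.inr ⟨by simp [hj], S.head_zero_of_lt (not_le.1 hj) _⟩
  · rintro ⟨a, ha, hap⟩
    have h1 := (ha.tail n).shift n
    refine ⟨_, S.mem_fracSet_iff.2 ⟨_, fun j hj => ?_, h1⟩, ?_⟩
    · simp only [DigitSystem.tail]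
      exact if_pos (by omega)
    · have : S.headVal n p = S.headVal n a := by
        have : S.head n p = S.head n a := by
          ext j
          by_cases hj : j ≤ n
          · simp [head, hj, hap j hj]
          · simp [head, hj]
        rw [headVal, headVal, this]
      simp only [zpow_neg_mulVec_zpow_mulVec, this]
      abel

end Representations

end DigitSystem

namespace DigitSystem

variable {d : ℕ} (S : DigitSystem d)

/-! ### Digits as a complete residue system. -/

section Residues

lemma mulVecLin_injective : Function.Injective (Matrix.mulVecLin S.M) := by
  rw [← LinearMap.ker_eq_bot, LinearMap.ker_eq_bot']
  exact fun v hv => Matrix.eq_zero_of_mulVec_eq_zero S.det_ne_zero hv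

lemma card_quotient : Nat.card ((Fin d → ℤ) ⧸ LinearMap.range (Matrix.mulVecLin S.M)) = S.m := by
  have h := Submodule.natAbs_det_equiv (LinearMap.range (Matrix.mulVecLin S.M))
    (LinearEquiv.ofInjective (Matrix.mulVecLin S.M) S.mulVecLin_injective)
  rw [← h, m, ← LinearMap.det_toLin' S.M]
  congr 2

/-- The digits are a complete system of residues. -/
lemma bijective_mk_digit : Function.Bijective fun i : Fin S.m =>
    (Submodule.Quotient.mk (S.digit i) :
      (Fin d → ℤ) ⧸ LinearMap.range (Matrix.mulVecLin S.M)) := by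
  have : Finite ((Fin d → ℤ) ⧸ LinearMap.range (Matrix.mulVecLin S.M)) :=
    Nat.finite_of_card_ne_zero (by rw [card_quotient]; exact S.m_pos.ne')
  have := Fintype.ofFinite ((Fin d → ℤ) ⧸ LinearMap.range (Matrix.mulVecLin S.M))
  rw [Fintype.bijective_iff_injective_and_card]
  refine ⟨fun i j h => S.digit_incongruent i j ?_, ?_⟩
  · obtain ⟨t, ht⟩ := (Submodule.Quotient.eq _).1 h
    exact ⟨t, ht.symm⟩
  · rw [← Nat.card_eq_fintype_card (α := _ ⧸ _), card_quotient, Fintype.card_fin]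

lemma exists_digit_add (z : Fin d → ℤ) : ∃ i t, z = S.digit i + S.M *ᵥ t := by
  obtain ⟨i, hi⟩ := S.bijective_mk_digit.2 (Submodule.Quotient.mk z)
  obtain ⟨t, ht⟩ := (Submodule.Quotient.eq _).1 hi.symm
  exact ⟨i, t, sub_eq_iff_eq_add'.1 ht.symm⟩

end Residues

/-! ### Volume of the self-similar set and its digit translates. -/

section Covering

/-- The integer lattice in `ℝ^d`. -/
def latticeSet (d : ℕ) : Set (Fin d → ℝ) := Set.range fun z : Fin d → ℤ => fun i => (z i : ℝ)

lemma isClosed_latticeSet (d : ℕ) : IsClosed (latticeSet d) := by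
  have : latticeSet d = ⋂ i, (fun v : Fin d → ℝ => v i) ⁻¹' Set.range ((↑) : ℤ → ℝ) := by
    ext v
    simp only [latticeSet, Set.mem_range, Set.mem_iInter, Set.mem_preimage]
    constructor
    · rintro ⟨z, rfl⟩ i
      exact ⟨z i, rfl⟩
    · intro h
      choose z hz using h
      exact ⟨z, funext hz⟩
  rw [this]
  exact isClosed_iInter fun i =>
    Int.isClosedEmbedding_coe_real.isClosed_range.preimage (continuous_apply i)

lemma zero_mem_fracSet : (0 : Fin d → ℝ) ∈ S.fracSet := by
  refine S.mem_fracSet_iff.2 ⟨fun _ => S.zeroIdx, fun _ _ => rfl,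
    (finite_iff_eventually _ _).2 ⟨0, fun _ _ => rfl⟩, ?_⟩
  simp only [digitR_zeroIdx, Matrix.mulVec_zero]
  exact hasSum_zero

/-- The representation with a single nonzero digit at position `0`. -/
lemma isRep_digit (i : Fin S.m) :
    S.IsRep (fun j => if j = 0 then i else S.zeroIdx) (S.digitR i) := by
  refine ⟨(finite_iff_eventually _ _).2 ⟨-1, fun j hj => if_neg (by omega)⟩, ?_⟩
  have := hasSum_single (f := fun j : ℤ =>
    (S.MR ^ (-j)) *ᵥ S.digitR (if j = 0 then i else S.zeroIdx)) 0 fun j hj => by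
      rw [if_neg hj, digitR_zeroIdx, Matrix.mulVec_zero]
  simpa using this

/-- Together with `exists_digit_add_of_mem` this is the self-similarity `M F = ⋃ (s + F)` over the
digits `s`. -/
lemma inv_mulVec_digit_add_mem {x : Fin d → ℝ} (hx : x ∈ S.fracSet) (i : Fin S.m) :
    (S.MR ^ (-1 : ℤ)) *ᵥ (S.digitR i + x) ∈ S.fracSet := by
  obtain ⟨a, ha, hrep⟩ := S.mem_fracSet_iff.1 hx
  have h := ((S.isRep_digit i).merge (e := fun j => if j = 0 then i else a j) hrep fun j => by
    by_cases hj : j = 0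
    · exact Or.inl ⟨by simp [hj], ha j hj.le⟩
    · exact Or.inr ⟨by simp [hj], by simp [hj]⟩).shift (-1)
  refine S.mem_fracSet_iff.2 ⟨_, fun j hj => ?_, h⟩
  rw [if_neg (by omega), ha _ (by omega)]

lemma exists_digit_add_of_mem {x : Fin d → ℝ} (hx : x ∈ S.fracSet) :
    ∃ i, ∃ y ∈ S.fracSet, S.MR *ᵥ x = S.digitR i + y := by
  obtain ⟨a, ha, hrep⟩ := S.mem_fracSet_iff.1 hx
  have h := hrep.shift 1
  refine ⟨a 1, S.MR *ᵥ x - S.digitR (a 1), S.mem_fracSet_iff.2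
    ⟨fun j => if j = 0 then S.zeroIdx else a (j + 1), fun j hj => ?_, ?_⟩, by abel⟩
  · by_cases h0 : j = 0
    · simp [h0]
    · simp only [h0, if_false]
      exact ha _ (by omega)
  · refine ⟨(finite_iff_eventually _ _).2 ⟨-1, fun j hj => ?_⟩, ?_⟩
    · rw [if_neg (by omega), ha _ (by omega)]
    · rw [zpow_one] at h
      refine (h.2.sub (S.isRep_digit (a 1)).2).congr_fun fun j => ?_
      by_cases h0 : j = 0 <;> simp [h0, digitR_zeroIdx]

lemma MR_mulVec_intCast (z : Fin d → ℤ) :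
    S.MR *ᵥ (fun i => (z i : ℝ)) = fun i => ((S.M *ᵥ z) i : ℝ) := by
  ext i
  simp [MR, Matrix.mulVec, dotProduct]

/-- Split the lattice part as `s + M t` with a digit `s`: then `M⁻¹ (y + s + M t) = M⁻¹ (s + y) +
t`. -/
lemma inv_mulVec_mem_add_lattice {x : Fin d → ℝ} (hx : x ∈ S.fracSet + latticeSet d) :
    (S.MR ^ (-1 : ℤ)) *ᵥ x ∈ S.fracSet + latticeSet d := by
  obtain ⟨y, hy, _, ⟨z, rfl⟩, rfl⟩ := hx
  obtain ⟨i, t, rfl⟩ := S.exists_digit_add z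
  refine ⟨_, S.inv_mulVec_digit_add_mem hy i, _, ⟨t, rfl⟩, ?_⟩
  have h : (fun j => ((S.digit i + S.M *ᵥ t) j : ℝ)) =
      S.digitR i + S.MR *ᵥ fun j => (t j : ℝ) := by
    rw [MR_mulVec_intCast]
    ext j
    simp [digitR]
  have h1 : (S.MR ^ (-1 : ℤ)) *ᵥ (S.MR *ᵥ fun j => (t j : ℝ)) = fun j => (t j : ℝ) := by
    simpa using S.zpow_neg_mulVec_zpow_mulVec 1 fun j => (t j : ℝ)
  simp only
  rw [h, ← add_assoc, Matrix.mulVec_add (_) (y + _), h1, add_comm y]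

/-- The integer translates of the self-similar set cover the space. -/
lemma fracSet_add_lattice : S.fracSet + latticeSet d = Set.univ := by
  refine Set.eq_univ_of_forall fun x => ?_
  have hcl : IsClosed (S.fracSet + latticeSet d) :=
    (isClosed_latticeSet d).add_left_of_isCompact S.isCompact_fracSet
  have hpow : ∀ (n : ℕ) (z : Fin d → ℤ),
      (S.MR ^ (-(n : ℤ))) *ᵥ (fun i => (z i : ℝ)) ∈ S.fracSet + latticeSet d := by
    intro n z
    induction n with
    | zero => exact ⟨0, S.zero_mem_fracSet, _, ⟨z, rfl⟩, by simp⟩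
    | succ n ih =>
      have := S.inv_mulVec_mem_add_lattice ih
      rw [zpow_mulVec_zpow_mulVec] at this
      convert this using 3
      push_cast
      ring
  obtain ⟨C, ρ, h0, h1, h⟩ := S.exists_norm_inv_pow_mulVec_le
  -- Rounding `M^n x` to the lattice and scaling back approximates `x` by points already covered;
  -- the sum of a compact and a closed set is closed.
  set z : ℕ → Fin d → ℤ := fun n i => ⌊((S.MR ^ (n : ℤ)) *ᵥ x) i⌋
  refine hcl.mem_of_tendsto (f := fun n : ℕ => (S.MR ^ (-(n : ℤ))) *ᵥ fun i => (z n i : ℝ))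
    (b := atTop) ?_ (Eventually.of_forall fun n => hpow n _)
  rw [tendsto_iff_norm_sub_tendsto_zero]
  refine squeeze_zero (fun _ => norm_nonneg _) (g := fun n => |C| * ρ ^ n) (fun n => ?_) ?_
  · have hx : (S.MR ^ (-(n : ℤ))) *ᵥ (fun i => (z n i : ℝ)) - x =
        (S.MR ^ (-(n : ℤ))) *ᵥ ((fun i => (z n i : ℝ)) - (S.MR ^ (n : ℤ)) *ᵥ x) := by
      rw [Matrix.mulVec_sub, zpow_neg_mulVec_zpow_mulVec]
    rw [hx]
    refine (h n _).trans ?_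
    have hfl : ‖(fun i => (z n i : ℝ)) - (S.MR ^ (n : ℤ)) *ᵥ x‖ ≤ 1 := by
      rw [pi_norm_le_iff_of_nonneg zero_le_one]
      intro i
      have h2 := Int.floor_le (((S.MR ^ (n : ℤ)) *ᵥ x) i)
      have h3 := Int.lt_floor_add_one (((S.MR ^ (n : ℤ)) *ᵥ x) i)
      rw [Pi.sub_apply, Real.norm_eq_abs, abs_le]
      exact ⟨by linarith, by linarith⟩
    calc C * ρ ^ n * _ ≤ |C| * ρ ^ n * 1 := by
          gcongr
          exact le_abs_self C
      _ = _ := mul_one _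
  · have := (tendsto_pow_atTop_nhds_zero_of_lt_one h0.le h1).const_mul |C|
    rwa [mul_zero] at this

/-- Otherwise countably many null translates would cover the whole space. -/
lemma volume_fracSet_pos : 0 < volume S.fracSet := by
  rw [pos_iff_ne_zero]
  intro h0
  have h : (Set.univ : Set (Fin d → ℝ)) ⊆
      ⋃ z : Fin d → ℤ, (fun x => x + fun i => (z i : ℝ)) '' S.fracSet := by
    rw [← S.fracSet_add_lattice]
    rintro _ ⟨y, hy, _, ⟨z, rfl⟩, rfl⟩
    exact Set.mem_iUnion.2 ⟨z, y, hy, rfl⟩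
  have h2 : volume (Set.univ : Set (Fin d → ℝ)) = 0 :=
    measure_mono_null h (measure_iUnion_null fun z => by
      rw [Set.image_add_right, measure_preimage_add_right, h0])
  exact (NeZero.ne (volume : Measure (Fin d → ℝ))) (Measure.measure_univ_eq_zero.1 h2)

lemma volume_fracSet_ne_top : volume S.fracSet ≠ ∞ := S.isCompact_fracSet.measure_lt_top.ne

lemma abs_det_MR : |S.MR.det| = S.m := by
  rw [det_MR, m, Nat.cast_natAbs, Int.cast_abs]

lemma abs_det_zpow (n : ℤ) : |(S.MR ^ n).det| = (S.m : ℝ) ^ n := by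
  obtain ⟨k, rfl | rfl⟩ := n.eq_nat_or_neg
  · rw [zpow_natCast, zpow_natCast, Matrix.det_pow, abs_pow, abs_det_MR]
  · rw [Matrix.zpow_neg_natCast, Matrix.det_nonsing_inv, Ring.inverse_eq_inv', Matrix.det_pow,
      abs_inv, abs_pow, abs_det_MR, zpow_neg, zpow_natCast]

lemma volume_image_zpow (n : ℤ) (v : Fin d → ℝ) (s : Set (Fin d → ℝ)) :
    volume ((fun x => v + (S.MR ^ n) *ᵥ x) '' s) = ENNReal.ofReal ((S.m : ℝ) ^ n) * volume s := by
  have h : (fun x => v + (S.MR ^ n) *ᵥ x) '' s =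
      (fun x => v + x) '' (Matrix.toLin' (S.MR ^ n) '' s) := by
    rw [Set.image_image]
    rfl
  rw [h, Set.image_add_left, measure_preimage_add, Measure.addHaar_image_linearMap,
    LinearMap.det_toLin', abs_det_zpow]

/-- The copies `s + fracSet`, `s ∈ D`, overlap in null sets. -/
lemma aedisjoint_digit_add {i j : Fin S.m} (hij : i ≠ j) :
    volume (((fun x => S.digitR i + x) '' S.fracSet) ∩
      ((fun x => S.digitR j + x) '' S.fracSet)) = 0 := by
  set E : Fin S.m → Set (Fin d → ℝ) := fun i => (fun x => S.digitR i + x) '' S.fracSet with hE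
  have hvol : ∀ i, volume (E i) = volume S.fracSet := fun i => by
    simp only [hE, Set.image_add_left, measure_preimage_add]
  have hmeas : ∀ i, MeasurableSet (E i) := fun i =>
    (S.isCompact_fracSet.image (by fun_prop)).measurableSet
  -- The image `M F` has volume `m vol F` and is covered by `m` sets of volume `vol F`, so there is
  -- no room for an overlap of positive volume.
  have hcover : (fun x => 0 + (S.MR ^ (1 : ℤ)) *ᵥ x) '' S.fracSet ⊆
      (E i ∪ E j) ∪ ⋃ k ∈ (Finset.univ.erase i).erase j, E k := by
    rintro _ ⟨x, hx, rfl⟩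
    obtain ⟨k, y, hy, h⟩ := S.exists_digit_add_of_mem hx
    have hk : 0 + (S.MR ^ (1 : ℤ)) *ᵥ x ∈ E k := ⟨y, hy, by simp [h]⟩
    by_cases hki : k = i
    · exact Or.inl (Or.inl (hki ▸ hk))
    · by_cases hkj : k = j
      · exact Or.inl (Or.inr (hkj ▸ hk))
      · exact Or.inr (Set.mem_biUnion (by simp [hki, hkj]) hk)
  have h1 := measure_mono (μ := volume) hcover
  rw [volume_image_zpow, zpow_one, ENNReal.ofReal_natCast] at h1
  have h2 := measure_union_add_inter (μ := volume) (E i) (hmeas j)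
  have h3 := measure_biUnion_finset_le (μ := volume) ((Finset.univ.erase i).erase j) E
  simp only [hvol, Finset.sum_const, nsmul_eq_mul] at h3 h2
  have hcard : ((Finset.univ.erase i).erase j).card = S.m - 2 := by
    rw [Finset.card_erase_of_mem (by simp [hij.symm]), Finset.card_erase_of_mem (by simp)]
    simp
    omega
  have hm : (S.m : ℝ≥0∞) = 2 + ((S.m - 2 : ℕ) : ℝ≥0∞) := by
    have := S.two_le
    exact_mod_cast (show S.m = 2 + (S.m - 2) by omega)
  rw [hcard] at h3
  have hfin := S.volume_fracSet_ne_top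
  have h4 : (S.m : ℝ≥0∞) * volume S.fracSet + volume (E i ∩ E j) ≤
      (S.m : ℝ≥0∞) * volume S.fracSet + 0 := by
    calc (S.m : ℝ≥0∞) * volume S.fracSet + volume (E i ∩ E j)
        ≤ (volume (E i ∪ E j) + ((S.m - 2 : ℕ) : ℝ≥0∞) * volume S.fracSet) +
            volume (E i ∩ E j) := by
          gcongr
          exact h1.trans ((measure_union_le _ _).trans (by gcongr))
      _ = (volume (E i ∪ E j) + volume (E i ∩ E j)) +
          ((S.m - 2 : ℕ) : ℝ≥0∞) * volume S.fracSet := by ring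
      _ = _ := by rw [h2, hm]; ring
  exact nonpos_iff_eq_zero.1
    ((ENNReal.add_le_add_iff_left (ENNReal.mul_ne_top (ENNReal.natCast_ne_top _) hfin)).1 h4)

end Covering

/-! ### The exceptional set is null, and digits are unique off it. -/

section Exceptional

lemma volume_image_zpow_eq_zero (n : ℤ) (v : Fin d → ℝ) {s : Set (Fin d → ℝ)}
    (hs : volume s = 0) : volume ((fun x => v + (S.MR ^ n) *ᵥ x) '' s) = 0 := by
  rw [volume_image_zpow, hs, mul_zero]

/-- Two expansions with different first digits put `M u` into two different digit translates of the
self-similar set. -/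
lemma volume_Utilde : volume S.Utilde = 0 := by
  have hsub : S.Utilde ⊆ ⋃ i : Fin S.m, ⋃ j : Fin S.m, ⋃ _ : i ≠ j,
      (fun x => 0 + (S.MR ^ (-1 : ℤ)) *ᵥ x) '' (((fun x => S.digitR i + x) '' S.fracSet) ∩
      ((fun x => S.digitR j + x) '' S.fracSet)) := by
    rintro u ⟨a, b, ha, hb, hau, hbu, hab⟩
    have key : ∀ e : ℤ → Fin S.m, (∀ j ≤ 0, e j = S.zeroIdx) → S.IsRep e u →
        S.MR *ᵥ u ∈ (fun x => S.digitR (e 1) + x) '' S.fracSet := by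
      intro e he heu
      refine ⟨S.MR *ᵥ u - S.digitR (e 1), S.mem_fracSet_iff.2
        ⟨S.tail 0 fun j => e (j + 1), fun j hj => if_pos hj, ?_⟩, by simp⟩
      have h := (heu.shift 1).tail 0
      have h1 : S.headVal 0 (fun j => e (j + 1)) = S.digitR (e 1) := by
        have h2 := (S.isFiniteRep_headVal (heu.shift 1).eventually 0).1.2
        refine h2.unique ((S.isRep_digit (e 1)).2.congr_fun fun j => ?_)
        by_cases hj : j = 0
        · simp [head, hj]
        · by_cases hj' : j ≤ 0
          · simp [head, hj, hj', he (j + 1) (by omega)]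
          · simp [head, hj, hj']
      rwa [h1, zpow_one] at h
    refine Set.mem_iUnion.2 ⟨a 1, Set.mem_iUnion.2 ⟨b 1, Set.mem_iUnion.2 ⟨hab,
      S.MR *ᵥ u, ⟨key a ha hau, key b hb hbu⟩, ?_⟩⟩⟩
    simpa using S.zpow_neg_mulVec_zpow_mulVec 1 u
  refine measure_mono_null hsub (measure_iUnion_null fun i => measure_iUnion_null fun j =>
    measure_iUnion_null fun hij => S.volume_image_zpow_eq_zero _ _ (S.aedisjoint_digit_add hij))

lemma countable_Xzero : S.Xzero.Countable := by
  have hc : {a : ℤ → Fin S.m | {j | a j ≠ S.zeroIdx}.Finite}.Countable := by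
    have : {a : ℤ → Fin S.m | {j | a j ≠ S.zeroIdx}.Finite} ⊆
        Set.range fun g : (s : Finset ℤ) × (s → Fin S.m) =>
          fun j => if h : j ∈ g.1 then g.2 ⟨j, h⟩ else S.zeroIdx := by
      intro a ha
      refine ⟨⟨ha.toFinset, fun j => a j⟩, ?_⟩
      ext j
      by_cases hj : a j = S.zeroIdx <;> simp [hj]
    exact (Set.countable_range _).mono this
  refine (hc.image fun a => ∑' j : ℤ, (S.MR ^ (-j)) *ᵥ S.digitR (a j)).mono ?_
  rintro x ⟨a, ha⟩
  exact ⟨a, ha.2, ha.1.2.tsum_eq⟩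

lemma volume_Xtilde : volume S.Xtilde = 0 := by
  refine (measure_biUnion_null_iff S.countable_Xzero).2 fun h _ => measure_iUnion_null fun n => ?_
  have := S.volume_image_zpow_eq_zero n ((S.MR ^ n) *ᵥ h) S.volume_Utilde
  refine measure_mono_null ?_ this
  rintro _ ⟨u, hu, rfl⟩
  exact ⟨u, hu, by simp only [Matrix.mulVec_add, add_comm]⟩

/-- Take the first position where the expansions differ, shift it to position `1` and remove the
common head, an element of `X⁰`: what remains lies in `Ũ`. -/
lemma IsRep.unique {S : DigitSystem d} {x : Fin d → ℝ} (hx : x ∉ S.Xtilde) {a b : ℤ → Fin S.m}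
    (ha : S.IsRep a x) (hb : S.IsRep b x) : a = b := by
  by_contra hne
  obtain ⟨Na, hNa⟩ := ha.eventually
  obtain ⟨Nb, hNb⟩ := hb.eventually
  obtain ⟨j₀, hj₀, hmin⟩ := Int.exists_least_of_bdd (P := fun j => a j ≠ b j)
    ⟨min Na Nb, fun j hj => by
      by_contra h
      exact hj ((hNa j (by omega)).trans (hNb j (by omega)).symm)⟩ (Function.ne_iff.1 hne)
  set n := j₀ - 1 with hn
  have hlt : ∀ j ≤ 0, a (j + n) = b (j + n) := fun j hj => by
    by_contra h
    have := hmin _ h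
    omega
  have hhead : S.head 0 (fun j => a (j + n)) = S.head 0 fun j => b (j + n) := by
    ext j
    by_cases hj : j ≤ 0
    · simp [head, hj, hlt j hj]
    · simp [head, hj]
  have hhv : S.headVal 0 (fun j => a (j + n)) = S.headVal 0 fun j => b (j + n) := by
    rw [headVal, headVal, hhead]
  have ha' := (ha.shift n).tail 0
  have hb' := (hb.shift n).tail 0
  rw [← hhv] at hb'
  refine hx ?_
  refine Set.mem_biUnion ⟨_, S.isFiniteRep_headVal (ha.shift n).eventually 0⟩
    (Set.mem_iUnion.2 ⟨-n, _, ⟨_, _, fun j hj => if_pos hj, fun j hj => if_pos hj, ha', hb', ?_⟩, ?_⟩)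
  · simpa [DigitSystem.tail, hn] using hj₀
  · simp only [sub_add_cancel, zpow_neg_mulVec_zpow_mulVec]

end Exceptional

end DigitSystem

namespace DigitSystem

variable {d : ℕ} (S : DigitSystem d)

/-! ### Lebesgue measure on `X` as a digit model. -/

section Model

lemma Xzero_subset_Xplus : S.Xzero ⊆ S.Xplus := fun _ ⟨a, ha⟩ => ⟨a, ha.1⟩

lemma X_subset_Xplus : S.X ⊆ S.Xplus :=
  Set.union_subset Set.sdiff_subset S.Xzero_subset_Xplus

lemma isRep_digits {x : Fin d → ℝ} (hx : x ∈ S.Xplus) : S.IsRep (S.digits x) x := by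
  unfold digits
  split_ifs with h1 h2
  · exact h1.choose_spec.1
  · exact h2.choose_spec
  · exact absurd hx h2

lemma digits_eq_of_isRep {x : Fin d → ℝ} (hx : x ∉ S.Xtilde) {a : ℤ → Fin S.m}
    (ha : S.IsRep a x) : S.digits x = a :=
  (S.isRep_digits ⟨a, ha⟩).unique hx ha

lemma ae_notMem_Xtilde : ∀ᵐ x ∂(volume : Measure (Fin d → ℝ)), x ∉ S.Xtilde :=
  measure_eq_zero_iff_ae_notMem.1 S.volume_Xtilde

lemma X_ae_eq : S.X =ᵐ[volume] S.Xplus := by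
  filter_upwards [S.ae_notMem_Xtilde] with x hx
  exact propext ⟨fun h => S.X_subset_Xplus h, fun h => Or.inl ⟨h, hx⟩⟩

lemma eventually_zeroIdx : ∃ N : ℤ, ∀ j ≤ N, (fun _ : ℤ => S.zeroIdx) j = S.zeroIdx :=
  ⟨0, fun _ _ => rfl⟩

lemma measurableSet_tile (n : ℤ) (p : ℤ → Fin S.m) : MeasurableSet (S.tile n p) :=
  (S.isCompact_fracSet.image (by fun_prop)).measurableSet

lemma Xplus_eq_iUnion : S.Xplus = ⋃ k : ℕ, S.tile (-(k : ℤ)) fun _ => S.zeroIdx := by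
  ext x
  simp only [Set.mem_iUnion, S.mem_tile_iff S.eventually_zeroIdx]
  constructor
  · rintro ⟨a, ha⟩
    obtain ⟨N, hN⟩ := ha.eventually
    exact ⟨N.natAbs, a, ha, fun j hj => hN j (by omega)⟩
  · rintro ⟨_, a, ha, _⟩
    exact ⟨a, ha⟩

lemma measurableSet_Xplus : MeasurableSet S.Xplus := by
  rw [Xplus_eq_iUnion]
  exact MeasurableSet.iUnion fun k => S.measurableSet_tile _ _

lemma muX_eq : S.muX = volume.restrict S.Xplus := Measure.restrict_congr_set S.X_ae_eq

lemma ae_muX : ∀ᵐ x ∂S.muX, x ∈ S.Xplus ∧ x ∉ S.Xtilde := by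
  rw [muX_eq]
  filter_upwards [ae_restrict_mem S.measurableSet_Xplus, ae_restrict_of_ae S.ae_notMem_Xtilde]
    with x h1 h2 using ⟨h1, h2⟩

variable {S} in
lemma mem_cyl_iff_mem_tile {p : ℤ → Fin S.m} (hp : ∃ N : ℤ, ∀ j ≤ N, p j = S.zeroIdx) (n : ℤ)
    {x : Fin d → ℝ} (h1 : x ∈ S.Xplus) (h2 : x ∉ S.Xtilde) :
    x ∈ cyl S.digits n p ↔ x ∈ S.tile n p := by
  rw [S.mem_tile_iff hp]
  constructor
  · exact fun h => ⟨_, S.isRep_digits h1, h⟩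
  · rintro ⟨a, ha, hap⟩
    rw [← S.digits_eq_of_isRep h2 ha] at hap
    exact hap

lemma cyl_ae_eq_tile {p : ℤ → Fin S.m} (hp : ∃ N : ℤ, ∀ j ≤ N, p j = S.zeroIdx) (n : ℤ) :
    cyl S.digits n p =ᵐ[S.muX] S.tile n p := by
  filter_upwards [S.ae_muX] with x hx
  exact propext (mem_cyl_iff_mem_tile hp n hx.1 hx.2)

lemma tile_subset_Xplus {p : ℤ → Fin S.m} (hp : ∃ N : ℤ, ∀ j ≤ N, p j = S.zeroIdx) (n : ℤ) :
    S.tile n p ⊆ S.Xplus := fun x hx => by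
  obtain ⟨a, ha, _⟩ := (S.mem_tile_iff hp n).1 hx
  exact ⟨a, ha⟩

lemma muX_restrict_cyl {p : ℤ → Fin S.m} (hp : ∃ N : ℤ, ∀ j ≤ N, p j = S.zeroIdx) (n : ℤ) :
    S.muX.restrict (cyl S.digits n p) = volume.restrict (S.tile n p) := by
  rw [Measure.restrict_congr_set (S.cyl_ae_eq_tile hp n), muX_eq,
    Measure.restrict_restrict (S.measurableSet_tile n p),
    Set.inter_eq_left.2 (S.tile_subset_Xplus hp n)]

lemma nullMeasurableSet_cyl {p : ℤ → Fin S.m} (hp : ∃ N : ℤ, ∀ j ≤ N, p j = S.zeroIdx) (n : ℤ) :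
    NullMeasurableSet (cyl S.digits n p) S.muX :=
  (S.measurableSet_tile n p).nullMeasurableSet.congr (S.cyl_ae_eq_tile hp n).symm

lemma tendsto_headVal {a : ℤ → Fin S.m} {x : Fin d → ℝ} (ha : S.IsRep a x) :
    Tendsto (fun N : ℕ => S.headVal N a) atTop (𝓝 x) := by
  obtain ⟨C, ρ, h0, h1, h⟩ := S.exists_norm_inv_pow_mulVec_le
  obtain ⟨R, hR⟩ := S.isCompact_fracSet.isBounded.exists_norm_le
  have hR0 : 0 ≤ R := (norm_nonneg _).trans (hR 0 S.zero_mem_fracSet)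
  rw [tendsto_iff_norm_sub_tendsto_zero]
  refine squeeze_zero (fun _ => norm_nonneg _) (g := fun n => |C| * ρ ^ n * R) (fun n => ?_) ?_
  · obtain ⟨y, hy, hxy⟩ := (S.mem_tile_iff ha.eventually n).2 ⟨a, ha, fun _ _ => rfl⟩
    have : S.headVal n a - x = -((S.MR ^ (-(n : ℤ))) *ᵥ y) := by
      rw [← hxy]
      simp
    rw [this, norm_neg]
    refine (h n y).trans ?_
    gcongr
    · exact le_abs_self C
    · exact hR y hy
  · have := ((tendsto_pow_atTop_nhds_zero_of_lt_one h0.le h1).const_mul |C|).mul_const R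
    rwa [mul_zero, zero_mul] at this

lemma headVal_congr {n : ℤ} {a b : ℤ → Fin S.m} (h : ∀ j ≤ n, a j = b j) :
    S.headVal n a = S.headVal n b := by
  have : S.head n a = S.head n b := by
    ext j
    by_cases hj : j ≤ n
    · simp [head, hj, h j hj]
    · simp [head, hj]
  rw [headVal, headVal, this]

/-- A function of finitely many digits times a function all of whose cylinder integrals vanish is
integrable with zero integral. -/
lemma integral_headVal_smul_eq_zero {f : (Fin d → ℝ) → ℂ} {n N : ℤ} (hN : n ≤ N)
    {p : ℤ → Fin S.m} (hp : ∃ N : ℤ, ∀ j ≤ N, p j = S.zeroIdx)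
    (hf : IntegrableOn f (cyl S.digits n p) S.muX)
    (h0 : ∀ q : Finset.Ioc n N → Fin S.m,
      ∫ x in cyl S.digits N (overwrite p q), f x ∂S.muX = 0) (φ : (Fin d → ℝ) → ℝ) :
    IntegrableOn (fun x => φ (S.headVal N (S.digits x)) • f x) (cyl S.digits n p) S.muX ∧
      ∫ x in cyl S.digits n p, φ (S.headVal N (S.digits x)) • f x ∂S.muX = 0 := by
  have hnull : ∀ q : Finset.Ioc n N → Fin S.m,
      NullMeasurableSet (cyl S.digits N (overwrite p q)) S.muX := fun q =>
    S.nullMeasurableSet_cyl (eventually_overwrite hp q) N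
  rw [← iUnion_cyl_overwrite S.digits hN p] at hf ⊢
  have hcongr : ∀ q : Finset.Ioc n N → Fin S.m,
      (fun x => φ (S.headVal N (S.digits x)) • f x)
        =ᵐ[S.muX.restrict (cyl S.digits N (overwrite p q))]
      fun x => φ (S.headVal N (overwrite p q)) • f x := fun q => by
    filter_upwards [ae_restrict_mem₀ (hnull q)] with x hx
    rw [S.headVal_congr hx]
  have hint : IntegrableOn (fun x => φ (S.headVal N (S.digits x)) • f x)
      (⋃ q : Finset.Ioc n N → Fin S.m, cyl S.digits N (overwrite p q)) S.muX :=
    integrableOn_finite_iUnion.2 fun q =>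
      ((integrableOn_finite_iUnion.1 hf q).smul (φ (S.headVal N (overwrite p q)))).congr
        (hcongr q).symm
  refine ⟨hint, ?_⟩
  rw [integral_iUnion_ae hnull
    (fun q q' h => (pairwise_disjoint_cyl_overwrite S.digits n N p h).aedisjoint) hint]
  simp only [integral_congr_ae (hcongr _), integral_smul, h0, smul_zero, tsum_zero]

/-- It suffices to test against smooth compactly supported `φ`. Replacing `φ x` by its value at the
truncated expansion of `x` gives a function of finitely many digits, with zero integral against `f`;
dominated convergence does the rest. -/
lemma ae_eq_zero_of_integral_cyl {f : (Fin d → ℝ) → ℂ} {n : ℤ} {p : ℤ → Fin S.m}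
    (hp : ∃ N : ℤ, ∀ j ≤ N, p j = S.zeroIdx) (hf : IntegrableOn f (cyl S.digits n p) S.muX)
    (h0 : ∀ N, n ≤ N → ∀ q : Finset.Ioc n N → Fin S.m,
      ∫ x in cyl S.digits N (overwrite p q), f x ∂S.muX = 0) :
    ∀ᵐ x ∂S.muX, x ∈ cyl S.digits n p → f x = 0 := by
  rw [← ae_restrict_iff'₀ (S.nullMeasurableSet_cyl hp n)]
  have hf' := hf
  rw [IntegrableOn] at hf'
  rw [muX_restrict_cyl S hp] at hf' ⊢
  have hT := S.measurableSet_tile n p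
  have hg : Integrable ((S.tile n p).indicator f) volume := (integrable_indicator_iff hT).2 hf'
  have key := ae_eq_zero_of_integral_contDiff_smul_eq_zero hg.locallyIntegrable
    fun φ hφ hφc => by
      have h1 : ∫ x, φ x • (S.tile n p).indicator f x = ∫ x in cyl S.digits n p, φ x • f x ∂S.muX := by
        rw [muX_restrict_cyl S hp, ← integral_indicator hT]
        congr 1
        ext x
        by_cases hx : x ∈ S.tile n p <;> simp [hx]
      rw [h1]
      obtain ⟨B, hB⟩ := hφc.exists_bound_of_continuous hφ.continuous
      -- Truncation levels below `n` would not refine the given cylinder.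
      have h2 : ∀ N : ℕ, n ≤ max n N := fun N => le_max_left _ _
      refine tendsto_nhds_unique (tendsto_integral_of_dominated_convergence
        (F := fun (N : ℕ) x => φ (S.headVal (max n N) (S.digits x)) • f x)
        (fun x => B * ‖f x‖)
        (fun N => (S.integral_headVal_smul_eq_zero (h2 N) hp hf (h0 _ (h2 N)) φ).1.1)
        (hf.norm.const_mul B) (fun N => Eventually.of_forall fun x => ?_) ?_) ?_
      · rw [norm_smul]
        exact mul_le_mul_of_nonneg_right (hB _) (norm_nonneg _)
      · filter_upwards [ae_restrict_of_ae S.ae_muX] with x hx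
        have h3 := ((hφ.continuous.tendsto x).comp
          (S.tendsto_headVal (S.isRep_digits hx.1))).smul_const (f x)
        refine h3.congr' ?_
        filter_upwards [eventually_ge_atTop n.natAbs] with N hN
        rw [max_eq_right (by omega)]
        rfl
      · simp only [fun N : ℕ =>
          (S.integral_headVal_smul_eq_zero (h2 N) hp hf (h0 _ (h2 N)) φ).2]
        exact tendsto_const_nhds
  rw [ae_restrict_iff' hT]
  filter_upwards [key] with x hx hxT
  rwa [Set.indicator_of_mem hxT] at hx

lemma volume_tile (n : ℤ) (p : ℤ → Fin S.m) :
    volume (S.tile n p) = ENNReal.ofReal (volume.real S.fracSet * (S.m : ℝ) ^ (-n)) := by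
  rw [tile, volume_image_zpow, mul_comm, ENNReal.ofReal_mul measureReal_nonneg, Measure.real,
    ENNReal.ofReal_toReal S.volume_fracSet_ne_top]

/-- Lebesgue measure on `X` with the digits of the vectors is a digit model. -/
theorem isDigitModel :
    IsDigitModel S.muX S.zeroIdx S.digits (volume.real S.fracSet) where
  pos := ENNReal.toReal_pos S.volume_fracSet_pos.ne' S.volume_fracSet_ne_top
  ae_eventually := by
    filter_upwards [S.ae_muX] with x hx
    exact (S.isRep_digits hx.1).eventually
  nullMeasurableSet_cyl n _ hp := S.nullMeasurableSet_cyl hp n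
  measure_cyl n p hp := by
    rw [Fintype.card_fin, ← volume_tile, ← Measure.restrict_apply_univ, S.muX_restrict_cyl hp,
      Measure.restrict_apply_univ]
  ae_eq_zero _ _ _ hp hf h0 := S.ae_eq_zero_of_integral_cyl hp hf h0

end Model

/-! ### Cells and dilates of `U` as cylinders. -/

section Cells

lemma coord_eq_zero_iff (x : Fin d → ℝ) (j : ℤ) : S.coord x j = 0 ↔ S.digits x j = S.zeroIdx :=
  S.digitR_eq_zero_iff _

/-- `U` is contained in the self-similar set, and the rest of that set lies in the null set `X̃`. -/
lemma image_U_ae_eq (n : ℤ) (v : Fin d → ℝ) :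
    (fun x => v + (S.MR ^ n) *ᵥ x) '' S.U =ᵐ[volume]
      (fun x => v + (S.MR ^ n) *ᵥ x) '' S.fracSet := by
  have hsub : S.U ⊆ S.fracSet := fun x hx => S.mem_fracSet_iff.2
    ⟨_, fun j hj => (S.coord_eq_zero_iff x j).1 (hx.2 j hj), S.isRep_digits (S.X_subset_Xplus hx.1)⟩
  have hsub' : S.fracSet ⊆ S.U ∪ S.Xtilde := fun x hx => by
    by_cases hxt : x ∈ S.Xtilde
    · exact Or.inr hxt
    · obtain ⟨a, ha, hrep⟩ := S.mem_fracSet_iff.1 hx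
      refine Or.inl ⟨Or.inl ⟨⟨a, hrep⟩, hxt⟩, fun j hj => ?_⟩
      rw [coord_eq_zero_iff, S.digits_eq_of_isRep hxt hrep, ha j hj]
  refine (LE.le.eventuallyLE (Set.image_mono hsub)).antisymm ?_
  rw [ae_le_set]
  refine measure_mono_null ?_ (S.volume_image_zpow_eq_zero n v S.volume_Xtilde)
  rintro _ ⟨⟨x, hx, rfl⟩, hn⟩
  rcases hsub' hx with h | h
  · exact absurd ⟨x, h, rfl⟩ hn
  · exact ⟨x, h, rfl⟩

lemma volume_real_U : volume.real S.U = volume.real S.fracSet := by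
  have h := S.image_U_ae_eq 0 0
  simp only [zpow_zero, Matrix.one_mulVec, zero_add, Set.image_id'] at h
  rw [Measure.real, measure_congr h, Measure.real]

lemma headVal_zero (n : ℤ) : S.headVal n (fun _ => S.zeroIdx) = 0 := by
  rw [headVal]
  refine finsum_eq_zero_of_forall_eq_zero fun j => ?_
  simp [head, digitR_zeroIdx]

lemma dilU_ae_eq_tile (n : ℤ) : S.dilU n =ᵐ[volume] S.tile (-n) fun _ => S.zeroIdx := by
  have h := S.image_U_ae_eq n 0
  simp only [zero_add] at h
  rw [dilU, tile, headVal_zero, neg_neg]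
  simpa only [zero_add] using h

/-- The digits of `γ_{[k]}`. -/
def gamDigits (k : ℕ) : ℤ → Fin S.m := fun j =>
  if j ≤ 0 then ⟨k / S.m ^ (-j).toNat % S.m, Nat.mod_lt _ S.m_pos⟩ else S.zeroIdx

lemma div_pow_eq_zero {k i : ℕ} (hi : k ≤ i) : k / S.m ^ i = 0 :=
  Nat.div_eq_of_lt (hi.trans_lt (Nat.lt_pow_self S.two_le))

lemma gamDigits_eventually (k : ℕ) : ∃ N : ℤ, ∀ j ≤ N, S.gamDigits k j = S.zeroIdx := by
  refine ⟨-k, fun j hj => ?_⟩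
  rw [gamDigits, if_pos (by omega), zeroIdx]
  ext
  simp [S.div_pow_eq_zero (show k ≤ (-j).toNat by omega)]

lemma isRep_gam (k : ℕ) : S.IsRep (S.gamDigits k) (S.gam k) := by
  refine ⟨(finite_iff_eventually _ _).2 (S.gamDigits_eventually k), ?_⟩
  have hinj : Function.Injective fun i : ℕ => -(i : ℤ) := fun a b h => by simpa using h
  refine (hinj.hasSum_iff fun j hj => ?_).1 ?_
  · rw [gamDigits, if_neg, digitR_zeroIdx, Matrix.mulVec_zero]
    intro h
    exact hj ⟨j.natAbs, by simp only; omega⟩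
  · have h : ∀ i ∉ Finset.range k,
        (S.MR ^ i) *ᵥ S.digitR ⟨k / S.m ^ i % S.m, Nat.mod_lt _ S.m_pos⟩ = 0 := fun i hi => by
      have : (⟨k / S.m ^ i % S.m, Nat.mod_lt _ S.m_pos⟩ : Fin S.m) = S.zeroIdx := by
        ext
        simp [zeroIdx, S.div_pow_eq_zero (not_lt.1 (Finset.mem_range.not.1 hi))]
      rw [this, digitR_zeroIdx, Matrix.mulVec_zero]
    refine (hasSum_sum_of_ne_finset_zero h).congr_fun fun i => ?_
    simp [gamDigits]

lemma exists_digits_nat (L : ℕ) : ∀ s : ℕ → Fin S.m, (∀ i, L ≤ i → s i = S.zeroIdx) →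
    ∃ k : ℕ, ∀ i, k / S.m ^ i % S.m = s i := by
  induction L with
  | zero => exact fun s hs => ⟨0, fun i => by simp [hs i (Nat.zero_le i), zeroIdx]⟩
  | succ L ih =>
    intro s hs
    obtain ⟨k, hk⟩ := ih (fun i => s (i + 1)) fun i hi => hs _ (by omega)
    refine ⟨s 0 + S.m * k, fun i => ?_⟩
    cases i with
    | zero => simp [Nat.mod_eq_of_lt (s 0).2]
    | succ i =>
      rw [pow_succ', ← Nat.div_div_eq_div_mul, Nat.add_mul_div_left _ _ S.m_pos,
        Nat.div_eq_of_lt (s 0).2, zero_add, hk]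

/-- By base-`m` expansion, every admissible prefix up to `n` comes from some `k`, so no cylinder is
missed by the cells. -/
lemma exists_gamDigits_shift {p : ℤ → Fin S.m} (hp : ∃ N : ℤ, ∀ j ≤ N, p j = S.zeroIdx) (n : ℤ) :
    ∃ k, ∀ j ≤ n, p j = S.gamDigits k (j + -n) := by
  obtain ⟨N, hN⟩ := hp
  obtain ⟨k, hk⟩ := S.exists_digits_nat (n - N).natAbs (fun i => p (n - i))
    fun i hi => hN _ (by omega)
  refine ⟨k, fun j hj => ?_⟩
  rw [gamDigits, if_pos (by omega)]
  ext
  have := hk (-(j + -n)).toNat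
  rw [Int.toNat_of_nonneg (by omega)] at this
  simp only [this]
  congr 2
  ring

lemma cell_ae_eq_tile (n : ℤ) (k : ℕ) :
    S.cell n k =ᵐ[volume] S.tile n fun j => S.gamDigits k (j + -n) := by
  have h := S.image_U_ae_eq (-n) ((S.MR ^ (-n)) *ᵥ S.gam k)
  have h1 := (S.isRep_gam k).shift (-n)
  have h2 : S.head n (fun j => S.gamDigits k (j + -n)) = fun j => S.gamDigits k (j + -n) := by
    ext j
    by_cases hj : j ≤ n
    · simp [head, hj]
    · simp only [head, hj, if_false, gamDigits]
      rw [if_neg (by omega)]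
  have h3 : S.headVal n (fun j => S.gamDigits k (j + -n)) = (S.MR ^ (-n)) *ᵥ S.gam k := by
    have h4 := (S.isFiniteRep_headVal h1.eventually n).1.2
    rw [h2] at h4
    exact h4.unique h1.2
  rw [tile, h3, cell, dilU, Set.image_image]
  exact h

lemma cell_ae_eq_cyl (n : ℤ) (k : ℕ) :
    S.cell n k =ᵐ[S.muX] cyl S.digits n fun j => S.gamDigits k (j + -n) :=
  (Measure.restrict_le_self.absolutelyContinuous.ae_eq (S.cell_ae_eq_tile n k)).trans
    (S.cyl_ae_eq_tile ((S.isRep_gam k).shift (-n)).eventually n).symm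

lemma dilU_ae_eq_cyl (n : ℤ) :
    S.dilU n =ᵐ[S.muX] cyl S.digits (-n) fun _ => S.zeroIdx :=
  (Measure.restrict_le_self.absolutelyContinuous.ae_eq (S.dilU_ae_eq_tile n)).trans
    (S.cyl_ae_eq_tile S.eventually_zeroIdx (-n)).symm

lemma isStep_iff (n : ℤ) (f : (Fin d → ℝ) → ℂ) : S.IsStep n f ↔
    ∀ p : ℤ → Fin S.m, (∃ N : ℤ, ∀ j ≤ N, p j = S.zeroIdx) →
      ∃ z : ℂ, ∀ᵐ x ∂S.muX, x ∈ cyl S.digits n p → f x = z := by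
  have hcell : ∀ k z, (∀ᵐ x ∂S.muX, x ∈ S.cell n k → f x = z) ↔
      ∀ᵐ x ∂S.muX, x ∈ cyl S.digits n (fun j => S.gamDigits k (j + -n)) → f x = z := by
    intro k z
    refine eventually_congr ?_
    filter_upwards [(S.cell_ae_eq_cyl n k).mem_iff] with x hx
    rw [hx]
  constructor
  · intro h p hp
    obtain ⟨k, hk⟩ := S.exists_gamDigits_shift hp n
    obtain ⟨z, hz⟩ := h k
    exact ⟨z, by rwa [cyl_congr S.digits hk, ← hcell]⟩
  · intro h k
    obtain ⟨z, hz⟩ := h _ ((S.isRep_gam k).shift (-n)).eventually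
    exact ⟨z, (hcell k z).2 hz⟩

lemma suppSubset_iff (n : ℤ) (g : (Fin d → ℝ) → ℂ) : S.SuppSubset n g ↔
    ∀ᵐ x ∂S.muX, x ∉ (cyl S.digits (-n) fun _ => S.zeroIdx) → g x = 0 := by
  refine eventually_congr ?_
  filter_upwards [(S.dilU_ae_eq_cyl n).mem_iff] with x hx
  rw [hx]

end Cells

end DigitSystem

namespace DigitSystem

variable {d : ℕ} (S : DigitSystem d)

/-! ### The pairing of residues and the kernel `χ`. -/

section Characters

open ComplexConjugate

/-- The character `t ↦ exp (2πi ⟨w, t⟩)` of the integer lattice. -/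
def latticeChar (w : Fin d → ℝ) (t : Fin d → ℤ) : ℂ :=
  Complex.exp (2 * Real.pi * Complex.I * ((w ⬝ᵥ fun i => (t i : ℝ) : ℝ) : ℂ))

lemma latticeChar_add (w : Fin d → ℝ) (t t' : Fin d → ℤ) :
    latticeChar w (t + t') = latticeChar w t * latticeChar w t' := by
  rw [latticeChar, latticeChar, latticeChar, ← Complex.exp_add, ← mul_add, ← Complex.ofReal_add,
    ← dotProduct_add]
  congr 5
  ext i
  simp

lemma latticeChar_eq_one_iff (w : Fin d → ℝ) (t : Fin d → ℤ) :
    latticeChar w t = 1 ↔ ∃ n : ℤ, (w ⬝ᵥ fun i => (t i : ℝ)) = n := by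
  rw [latticeChar, Complex.exp_eq_one_iff]
  refine exists_congr fun n => ?_
  rw [mul_comm, mul_left_inj' Complex.two_pi_I_ne_zero]
  norm_cast

lemma MR_mulVec_inv_mulVec (v : Fin d → ℝ) : S.MR *ᵥ (S.MR⁻¹ *ᵥ v) = v := by
  rw [Matrix.mulVec_mulVec, Matrix.mul_nonsing_inv _ S.isUnit_det_MR, Matrix.one_mulVec]

/-- Translation by `t₀` permutes the residues, so it fixes the sum while multiplying it by a number
other than `1`. -/
lemma sum_latticeChar_eq_zero {w : Fin d → ℝ} (h1 : ∀ t, latticeChar w (S.M *ᵥ t) = 1)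
    {t₀ : Fin d → ℤ} (h0 : latticeChar w t₀ ≠ 1) : ∑ b, latticeChar w (S.digit b) = 0 := by
  set e := Equiv.ofBijective _ S.bijective_mk_digit
  set σ := e.trans ((Equiv.addRight (Submodule.Quotient.mk t₀)).trans e.symm) with hσ
  have h : ∀ b, latticeChar w (S.digit (σ b)) = latticeChar w (S.digit b) * latticeChar w t₀ := by
    intro b
    have he : e (σ b) = e b + Submodule.Quotient.mk t₀ := by simp [hσ]
    have he' : (Submodule.Quotient.mk (S.digit (σ b)) :
        (Fin d → ℤ) ⧸ LinearMap.range (Matrix.mulVecLin S.M)) =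
        Submodule.Quotient.mk (S.digit b + t₀) := he
    obtain ⟨t, ht⟩ := (Submodule.Quotient.eq _).1 he'
    rw [← sub_add_cancel (S.digit (σ b)) (S.digit b + t₀), ← ht, Matrix.mulVecLin_apply,
      latticeChar_add, h1, one_mul, latticeChar_add]
  have h2 := Equiv.sum_comp σ fun b => latticeChar w (S.digit b)
  simp only [h, ← Finset.sum_mul] at h2
  by_contra hne
  exact h0 (mul_left_cancel₀ hne (h2.trans (mul_one _).symm))

/-- The matrix of the pairing of the residues modulo `M` and modulo its transpose. -/
def pairing (T : DigitSystem d) (a : Fin S.m) (b : Fin T.m) : ℂ :=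
  latticeChar (S.MR⁻¹ *ᵥ S.digitR a) (T.digit b)

/-- The summand is the character of `w = M⁻¹ (s_{a'} - s_a)`. It is trivial on `M* ℤ^d` because
`⟨M⁻¹ v, M* t⟩ = ⟨v, t⟩`. It is trivial on all of `ℤ^d` only if `w` is integral, that is, if the two
digits are congruent. -/
lemma pairing_orthogonal (T : DigitSystem d) (hT : T.M = S.Mᵀ) (a a' : Fin S.m) :
    ∑ b, conj (S.pairing T a b) * S.pairing T a' b =
      if a = a' then ((Fintype.card (Fin S.m) : ℝ) : ℂ) else 0 := by
  set w := S.MR⁻¹ *ᵥ (S.digitR a' - S.digitR a) with hw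
  have hterm : ∀ b, conj (S.pairing T a b) * S.pairing T a' b = latticeChar w (T.digit b) := by
    intro b
    rw [pairing, pairing, latticeChar, latticeChar, latticeChar, ← Complex.exp_conj,
      ← Complex.exp_add, hw, Matrix.mulVec_sub, sub_dotProduct]
    congr 1
    simp only [map_mul, Complex.conj_ofReal, Complex.conj_I, map_ofNat, Complex.ofReal_sub]
    ring
  simp only [hterm]
  split_ifs with h
  · subst h
    have h1 : ∀ b, latticeChar w (T.digit b) = 1 := fun b => by
      rw [latticeChar_eq_one_iff, hw, sub_self, Matrix.mulVec_zero, zero_dotProduct]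
      exact ⟨0, by simp⟩
    simp only [h1]
    simp only [Finset.sum_const, Finset.card_univ, Fintype.card_fin, nsmul_eq_mul, mul_one]
    rw [show T.m = S.m by rw [m, m, hT, Matrix.det_transpose], Complex.ofReal_natCast]
  · have hMw : S.MR *ᵥ w = fun i => ((S.digit a' - S.digit a) i : ℝ) := by
      rw [hw, MR_mulVec_inv_mulVec]
      ext i
      simp [digitR]
    by_cases htriv : ∀ t, latticeChar w t = 1
    · exfalso
      refine h (S.digit_incongruent a' a ?_).symm
      have hint : ∀ i, ∃ n : ℤ, w i = n := fun i => by
        obtain ⟨n, hn⟩ := (latticeChar_eq_one_iff w (Pi.single i 1)).1 (htriv _)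
        refine ⟨n, ?_⟩
        rw [← hn]
        simp [dotProduct, Pi.single_apply]
      choose t ht using hint
      refine ⟨t, ?_⟩
      rw [show w = fun i => (t i : ℝ) from funext ht, MR_mulVec_intCast] at hMw
      ext i
      have := congrFun hMw i
      exact_mod_cast this.symm
    · push Not at htriv
      obtain ⟨t₀, ht₀⟩ := htriv
      refine T.sum_latticeChar_eq_zero (fun t => ?_) ht₀
      rw [latticeChar_eq_one_iff]
      refine ⟨(S.digit a' - S.digit a) ⬝ᵥ t, ?_⟩
      have h2 : (fun i => ((T.M *ᵥ t) i : ℝ)) = S.MRᵀ *ᵥ fun i => (t i : ℝ) := by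
        rw [← MR_mulVec_intCast, MR, hT]
        rfl
      rw [h2, Matrix.dotProduct_mulVec, Matrix.vecMul_transpose, hMw]
      simp [dotProduct]

lemma isDigitKernel_chi (T : DigitSystem d) :
    IsDigitKernel S.zeroIdx T.zeroIdx S.digits T.digits (S.pairing T) (S.chi T) := by
  intro l N x ω hx hω
  have hsupp : (Function.support fun j : ℤ =>
      (S.MR⁻¹ *ᵥ S.coord x j) ⬝ᵥ T.coord ω (1 - j)) ⊆ Finset.Ioc (-l) N := by
    intro j hj
    by_contra h
    apply hj
    rw [Finset.coe_Ioc, Set.mem_Ioc, not_and_or, not_lt, not_le] at h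
    rcases h with h | h
    · simp only [(S.coord_eq_zero_iff x j).2 (hx j h), Matrix.mulVec_zero, zero_dotProduct]
    · simp only [(T.coord_eq_zero_iff ω (1 - j)).2 (hω (1 - j) (by omega)), dotProduct_zero]
  rw [chi, finsum_eq_sum_of_support_subset _ hsupp, Complex.ofReal_sum, Finset.mul_sum,
    Complex.exp_sum, ← Finset.prod_coe_sort]
  rfl

lemma truncFourier_eq (T : DigitSystem d) (l : ℕ) (f : (Fin d → ℝ) → ℂ) :
    S.truncFourier T l f =
      digitTransform S.muX S.zeroIdx S.digits (volume.real S.fracSet) (S.chi T) l f := by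
  ext ω
  rw [truncFourier, digitTransform, volume_real_U, S.muX_restrict_cyl S.eventually_zeroIdx,
    setIntegral_congr_set (S.dilU_ae_eq_tile l)]

end Characters

end DigitSystem

end

theorem mainTheorem8 {d : ℕ} (S T : DigitSystem d) (hT : T.M = S.Mᵀ) (n : ℤ)
    (f : (Fin d → ℝ) → ℂ) (hf : MemLp f 2 S.muX) :
    (∃ g, S.IsFourierTransform T f g) ∧
      ∀ g, S.IsFourierTransform T f g → (S.IsStep n f ↔ T.SuppSubset n g) := by
  have hcard : Fintype.card (Fin T.m) = Fintype.card (Fin S.m) := by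
    rw [Fintype.card_fin, Fintype.card_fin, DigitSystem.m, DigitSystem.m, hT, Matrix.det_transpose]
  have hW := S.pairing_orthogonal T hT
  have hκ := S.isDigitKernel_chi T
  constructor
  · obtain ⟨g, hg, hlim⟩ :=
      exists_tendsto_digitTransform S.isDigitModel T.isDigitModel hκ hcard hW hf
    refine ⟨g, hg, fun l => ?_, ?_⟩
    · rw [S.truncFourier_eq]
      exact memLp_digitTransform S.isDigitModel T.isDigitModel hκ hcard hW l hf
    · simpa only [S.truncFourier_eq] using hlim
  · rintro g ⟨hg, -, hlim⟩
    simp only [S.truncFourier_eq] at hlim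
    rw [S.isStep_iff, T.suppSubset_iff]
    exact step_iff_support S.isDigitModel T.isDigitModel hκ hcard hW hf hg hlim n
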